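/- Let $n\ge 1$ and $Y\in\mathbb{H}^{n\times n}$. For $m\ge 1$ let $\mathrm{H}_m(\mathbb{H})$ be the real vector space of selfadjoint $m\times m$ quaternionic matrices, and write $A\succeq 0$ if $A$ is selfadjoint and $\mathbf{x}^*A\mathbf{x}\ge 0$ for all $\mathbf{x}\in\mathbb{H}^m$. For $A,C\in\mathbb{H}^{n\times n}$ let $r(A)=\max\{|\mathbf{x}^*A\mathbf{x}|:\mathbf{x}\in\mathbb{H}^n,\ \|\mathbf{x}\|=1\}$ be the numerical radius and $r^\vee(C)=\max\{\Re\operatorname{tr}A^*C: A\in\mathbb{H}^{n\times n},\ r(A)\le 1\}$ its dual norm. Put $$H(Y)=\begin{bmatrix}0&Y\\Y^*&0\end{bmatrix}\in \mathrm{H}_{2n}(\mathbb{H}),\qquad k=n(2n-1).$$ A standard-form SDP in $\mathrm{H}_{2n}(\mathbb{H})$ with $k$ variables, given by $X_0,\dots,X_k\in\mathrm{H}_{2n}(\mathbb{H})$ and $c\in\mathbb{R}^k$, is the problem $$val=\inf\Big\{\sum_{i=1}^k c_is_i:\ s\in\mathbb{R}^k,\ X_0+\sum_{i=1}^k s_iX_i\succeq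 0\Big\},$$ where $X_1,\dots,X_k$ are linearly independent over $\mathbb{R}$ and either $X_0=0$ or $X_0,\dots,X_k$ are linearly independent over $\mathbb{R}$. Its dual is $$val^\vee=\sup\{-\Re\operatorname{tr}X_0Z:\ Z\in\mathrm{H}_{2n}(\mathbb{H}),\ Z\succeq 0,\ \Re\operatorname{tr}X_iZ=c_i,\ i=1,\dots,k\}.$$ Then $$r^\vee(Y)=\min\Big\{\operatorname{tr}W:\ \begin{bmatrix}W&Y\\Y^*&W\end{bmatrix}\succeq 0\Big\},\qquad(1)$$ and (1) is a standard-form SDP in $\mathrm{H}_{2n}(\mathbb{H})$ with $k=n(2n-1)$ variables. More precisely, there are real bases $W_1,\dots,W_k$ of $\mathrm{H}_n(\mathbb{H})$ with $W_1=\frac1n I_n$ and $\operatorname{tr}W_i=0$ for $i=2,\dots,k$, and for every such basis the following holds with $$X_0=H(Y),\quad X_i=\operatorname{diag}(W_i,W_i)\ (1\le i\le k),\quad c_1=1,\quad c_i=0\ (2\le i\le k).$$ (a) These data define a standard-form SDP, and it is problem (1): $s\mapsto W=\sum_{i=1}^k s_iW_i$ is a bijection of $\mathbb{R}^k$ onto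 $\mathrm{H}_n(\mathbb{H})$, and under it $$X_0+\sum_{i=1}^k s_iX_i=\begin{bmatrix}W&Y\\Y^*&W\end{bmatrix},\qquad \sum_{i=1}^k c_is_i=\operatorname{tr}W.$$ In particular $val=r^\vee(Y)$, and the infimum is attained. (b) Strong duality holds: $val=val^\vee$. Moreover, $$r^\vee(Y)=\max\{-\Re\operatorname{tr}H(Y)Z:\ \operatorname{tr}Z=n,\ \Re\operatorname{tr}X_iZ=0\ (i=2,\dots,k),\ Z\in\mathrm{H}_{2n}(\mathbb{H}),\ Z\succeq 0\},$$ where the maximum is attained. -/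

import Mathlib

open scoped Quaternion

noncomputable section

/-- `H_m(ℍ)`: the real vector space of selfadjoint quaternionic matrices indexed by `m`. -/
def QHerm (m : Type) [Fintype m] : Submodule ℝ (Matrix m m ℍ[ℝ]) where
  carrier := {A | A.IsHermitian}
  zero_mem' := Matrix.isHermitian_zero
  add_mem' := fun hA hB => Matrix.IsHermitian.add hA hB
  smul_mem' := fun c A hA => by
    ext i j : 1
    have h : star (A j i) = A i j := Matrix.IsHermitian.apply hA i j
    simp [Matrix.conjTranspose_apply, h]

/-- The number `x* A x`. -/
def qForm {m : Type} [Fintype m] (A : Matrix m m ℍ[ℝ]) (x : m → ℍ[ℝ]) : ℍ[ℝ] :=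
  star x ⬝ᵥ A.mulVec x

/-- Positive semidefinite: selfadjoint with `x* A x ≥ 0` for all `x`
(for selfadjoint `A` the quaternion `x* A x` is real, so it equals its real part). -/
def QPosSemidef {m : Type} [Fintype m] (A : Matrix m m ℍ[ℝ]) : Prop :=
  A.IsHermitian ∧ ∀ x : m → ℍ[ℝ], 0 ≤ (qForm A x).re

/-- The quaternionic numerical radius `r(A) = max {|x* A x| : ‖x‖ = 1}`. -/
def qNumRadius {n : ℕ} (A : Matrix (Fin n) (Fin n) ℍ[ℝ]) : ℝ :=
  sSup {t : ℝ | ∃ x : Fin n → ℍ[ℝ], ∑ i, ‖x i‖ ^ 2 = 1 ∧ t = ‖qForm A x‖}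

/-- The dual norm `r^∨(C) = max {Re tr (A* C) : r(A) ≤ 1}` of the numerical radius. -/
def qNumRadiusDual {n : ℕ} (C : Matrix (Fin n) (Fin n) ℍ[ℝ]) : ℝ :=
  sSup {t : ℝ | ∃ A : Matrix (Fin n) (Fin n) ℍ[ℝ],
    qNumRadius A ≤ 1 ∧ t = (A.conjTranspose * C).trace.re}

/-- Data of a semidefinite program in standard form, with `k` real variables, in `H_m(ℍ)`:
minimize `∑ i, c i * s i` subject to `X₀ + ∑ i, s i • X i ⪰ 0`. -/
structure QSDP (m : Type) [Fintype m] (k : ℕ) where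
  X₀ : QHerm m
  X : Fin k → QHerm m
  c : Fin k → ℝ

namespace QSDP

variable {m : Type} [Fintype m] {k : ℕ}

/-- `X₀ + ∑ i, s i • X i`. -/
def pencil (P : QSDP m k) (s : Fin k → ℝ) : Matrix m m ℍ[ℝ] :=
  (P.X₀ : Matrix m m ℍ[ℝ]) + ∑ i, s i • (P.X i : Matrix m m ℍ[ℝ])

/-- `∑ i, c i * s i`. -/
def objective (P : QSDP m k) (s : Fin k → ℝ) : ℝ := ∑ i, P.c i * s i

/-- Feasible points of the primal program. -/
def feasible (P : QSDP m k) : Set (Fin k → ℝ) := {s | QPosSemidef (P.pencil s)}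

/-- Value of the primal program (`⊤` if it is infeasible, `⊥` if it is unbounded). -/
def val (P : QSDP m k) : EReal := ⨅ s ∈ P.feasible, (P.objective s : EReal)

/-- Feasible points of the dual program: `Z ⪰ 0` with `Re tr (X i * Z) = c i` for all `i`. -/
def dualFeasible (P : QSDP m k) : Set (Matrix m m ℍ[ℝ]) :=
  {Z | QPosSemidef Z ∧ ∀ i, ((P.X i : Matrix m m ℍ[ℝ]) * Z).trace.re = P.c i}

/-- `-Re tr (X₀ * Z)`. -/
def dualObjective (P : QSDP m k) (Z : Matrix m m ℍ[ℝ]) : ℝ :=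
  -((P.X₀ : Matrix m m ℍ[ℝ]) * Z).trace.re

/-- Value of the dual program (`⊥` if it is infeasible, `⊤` if it is unbounded). -/
def dualVal (P : QSDP m k) : EReal := ⨆ Z ∈ P.dualFeasible, (P.dualObjective Z : EReal)

end QSDP

/-- `H(Y) = [0, Y; Y*, 0]`, an element of `H_{2n}(ℍ)` (rows and columns of `H_{2n}(ℍ)` are
indexed by two copies of `Fin n`). -/
def qH {n : ℕ} (Y : Matrix (Fin n) (Fin n) ℍ[ℝ]) : QHerm (Fin n ⊕ Fin n) :=
  ⟨Matrix.fromBlocks 0 Y Y.conjTranspose 0,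
    Matrix.IsHermitian.fromBlocks Matrix.isHermitian_zero rfl Matrix.isHermitian_zero⟩

/-- `diag(W, W)`, an element of `H_{2n}(ℍ)`. -/
def qDiag {n : ℕ} (W : QHerm (Fin n)) : QHerm (Fin n ⊕ Fin n) :=
  ⟨Matrix.fromBlocks (W : Matrix (Fin n) (Fin n) ℍ[ℝ]) 0 0 (W : Matrix (Fin n) (Fin n) ℍ[ℝ]),
    Matrix.IsHermitian.fromBlocks W.2 Matrix.conjTranspose_zero W.2⟩

/-- A real basis `W_1, …, W_k` of `H_n(ℍ)`, `k = n(2n-1)`, is adapted if `W_1 = (1/n) I_n` and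
`tr W_i = 0` for `i ≥ 2`. The index `i : Fin k` stands for the number `i + 1`. -/
def IsAdapted {n : ℕ} (W : Module.Basis (Fin (n * (2 * n - 1))) ℝ (QHerm (Fin n))) : Prop :=
  ∀ i : Fin (n * (2 * n - 1)), ((i : ℕ) = 0 → (W i : Matrix (Fin n) (Fin n) ℍ[ℝ]) = (1 / (n : ℝ)) • 1) ∧
    ((i : ℕ) ≠ 0 → (W i : Matrix (Fin n) (Fin n) ℍ[ℝ]).trace = 0)

/-- The program with `X₀ = H(Y)`, `X_i = diag(W_i, W_i)`, `c_1 = 1` and `c_i = 0` for `i ≥ 2`. -/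
def dualRadiusSDP {n : ℕ} (Y : Matrix (Fin n) (Fin n) ℍ[ℝ])
    (W : Module.Basis (Fin (n * (2 * n - 1))) ℝ (QHerm (Fin n))) :
    QSDP (Fin n ⊕ Fin n) (n * (2 * n - 1)) where
  X₀ := qH Y
  X := fun i => qDiag (W i)
  c := fun i => if (i : ℕ) = 0 then 1 else 0

end

/-!
The dual norm is computed by comparing the two problems with `r^∨(Y)` from both sides.

*Weak duality.* If `[V, Y; Y*, V] ⪰ 0` and `r(A) ≤ 1`, then `Re tr (A* Y) ≤ tr V`
(`re_trace_conjTranspose_mul_le`). Regard `ℍ^n` as a complex vector space of dimension `2n`. The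
complex matrix of `A` has numerical radius at most `1`, because its form is the complex part of the
quaternionic one. The complex matrix of `[V, Y; Y*, V]` is the Gram matrix of two families `p`, `q`
whose own Gram matrices coincide, so a unitary `U` carries `p` to `q`. Diagonalizing `U` with
eigenvalues `λ_l` exhibits the pair `(V, Y)` as a sum of pairs `(x_l x_l*, λ_l x_l x_l*)` with
`|λ_l| = 1`, and on such a pair the inequality is the definition of the numerical radius
(`re_sum_mul_inner_le_of_inner_eq`).

*Strong duality.* The minimum of `tr V` is attained by compactness (`exists_forall_re_trace_le`),
and the M. Riesz extension theorem provides a dual feasible `Z` with the same value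
(`exists_dual_of_forall_re_trace_le`); the identity being an order unit of the positive
semidefinite cone plays the part of Slater's condition.

*Return to the norm.* The off-diagonal block of a dual feasible `Z`, multiplied by `-2`, is a matrix
`A` with `r(A) ≤ 1` for which `Re tr (A* Y)` is the dual objective of `Z`
(`exists_qNumRadius_le_one_of_dual`). So the common optimal value is at most `r^∨(Y)`, and weak
duality gives equality.

Adapted bases arise by completing `(1/n) I` with a basis of the kernel of the trace; the dimension
`n(2n-1)` counts `n` real diagonal entries and `n(n-1)/2` quaternions above the diagonal.
-/

open scoped InnerProductSpace ComplexConjugate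

/-! ### Families of vectors with equal Gram matrices -/

section ComplexUnitary

variable {V : Type*} [NormedAddCommGroup V] [InnerProductSpace ℂ V]

theorem LinearIsometry.norm_eigenvalue_eq_one (U : V →ₗᵢ[ℂ] V) {c : ℂ} {v : V} (hv : v ≠ 0)
    (h : U v = c • v) : ‖c‖ = 1 := by
  have h1 := U.norm_map v
  rw [h, norm_smul] at h1
  exact mul_right_cancel₀ (norm_ne_zero_iff.2 hv) (by rw [h1, one_mul])

variable [FiniteDimensional ℂ V]

/-- Spectral theorem for a linear isometry of a finite-dimensional complex inner product space into
itself. Its eigenspaces are orthogonal, and the orthogonal complement of their sum is invariant, so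
it would contain an eigenvector if it were nonzero. -/
theorem LinearIsometry.exists_orthonormalBasis_eigenvectors (U : V →ₗᵢ[ℂ] V) :
    ∃ (b : OrthonormalBasis (Fin (Module.finrank ℂ V)) ℂ V)
      (c : Fin (Module.finrank ℂ V) → ℂ), ∀ l, ‖c l‖ = 1 ∧ U (b l) = c l • b l := by
  classical
  have hO : OrthogonalFamily ℂ
      (fun μ : Module.End.Eigenvalues U.toLinearMap =>
        Module.End.eigenspace U.toLinearMap (μ : ℂ))
      fun μ => (Module.End.eigenspace U.toLinearMap (μ : ℂ)).subtypeₗᵢ := by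
    refine OrthogonalFamily.of_pairwise fun μ ν hμν v hv w hw => ?_
    rw [Module.End.mem_eigenspace_iff] at hv hw
    change U v = _ at hv
    change U w = _ at hw
    by_contra hne
    have hv0 : v ≠ 0 := fun h => hne (by rw [h, inner_zero_right])
    have h1 := U.norm_eigenvalue_eq_one hv0 hv
    have h2 : ⟪w, v⟫_ℂ = conj (ν : ℂ) * (μ : ℂ) * ⟪w, v⟫_ℂ := by
      conv_lhs => rw [← U.inner_map_map, hv, hw, inner_smul_left, inner_smul_right]
      ring
    have h3 : conj (ν : ℂ) * (μ : ℂ) = 1 :=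
      mul_right_cancel₀ hne (by rw [← h2, one_mul])
    have hw0 : w ≠ 0 := fun h => hne (by rw [h, inner_zero_left])
    have h4 := U.norm_eigenvalue_eq_one hw0 hw
    have h5 : (ν : ℂ) * conj (ν : ℂ) = 1 := by
      rw [Complex.mul_conj, Complex.normSq_eq_norm_sq, h4]; simp
    apply hμν
    apply Subtype.ext
    calc (μ : ℂ) = ((ν : ℂ) * conj (ν : ℂ)) * μ := by rw [h5, one_mul]
      _ = ν := by rw [mul_assoc, h3, mul_one]
  have hbot : (⨆ μ : Module.End.Eigenvalues U.toLinearMap,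
      Module.End.eigenspace U.toLinearMap (μ : ℂ))ᗮ = ⊥ := by
    set S : Submodule ℂ V := ⨆ μ : Module.End.Eigenvalues U.toLinearMap,
      Module.End.eigenspace U.toLinearMap (μ : ℂ) with hS
    by_contra hne
    have hinv : ∀ w ∈ Sᗮ, U w ∈ Sᗮ := by
      intro w hw
      have : S ≤ (ℂ ∙ U w)ᗮ := by
        refine iSup_le fun μ v hv => ?_
        rw [Submodule.mem_orthogonal_singleton_iff_inner_left]
        have hvS : v ∈ S := (le_iSup (fun μ : Module.End.Eigenvalues U.toLinearMap =>
          Module.End.eigenspace U.toLinearMap (μ : ℂ)) μ) hv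
        by_cases hv0 : v = 0
        · rw [hv0, inner_zero_left]
        rw [Module.End.mem_eigenspace_iff] at hv
        change U v = _ at hv
        have h1 := U.norm_eigenvalue_eq_one hv0 hv
        have h2 : ⟪U v, U w⟫_ℂ = 0 := by
          rw [U.inner_map_map]
          exact (Submodule.mem_orthogonal S w).1 hw v hvS
        rw [hv, inner_smul_left] at h2
        rcases mul_eq_zero.1 h2 with h | h
        · have h3 : (μ : ℂ) = 0 := by simpa using h
          rw [h3] at h1
          simp at h1
        · exact h
      rw [Submodule.mem_orthogonal]
      intro v hv
      exact (Submodule.mem_orthogonal_singleton_iff_inner_left).1 (this hv)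
    have : Nontrivial Sᗮ := Submodule.nontrivial_iff_ne_bot.2 hne
    obtain ⟨c, hc⟩ := Module.End.exists_eigenvalue (U.toLinearMap.restrict hinv)
    obtain ⟨w, hw⟩ := hc.exists_hasEigenvector
    have hw1 : U (w : V) = c • (w : V) := by
      have := congrArg Subtype.val hw.apply_eq_smul
      simpa using! this
    have hw0 : (w : V) ≠ 0 := fun h => hw.2 (Subtype.ext h)
    have hev : Module.End.HasEigenvalue U.toLinearMap c :=
      Module.End.hasEigenvalue_of_hasEigenvector
        (Module.End.hasEigenvector_iff.2 ⟨Module.End.mem_eigenspace_iff.2 hw1, hw0⟩)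
    have hwS : (w : V) ∈ S := (le_iSup (fun μ : Module.End.Eigenvalues U.toLinearMap =>
          Module.End.eigenspace U.toLinearMap (μ : ℂ)) ⟨c, hev⟩)
            (Module.End.mem_eigenspace_iff.2 hw1)
    exact hw0 (inner_self_eq_zero.1 ((Submodule.mem_orthogonal S _).1 w.2 _ hwS))
  have hI := hO.isInternal_iff.2 hbot
  refine ⟨hI.subordinateOrthonormalBasis rfl hO,
    fun l => ((hI.subordinateOrthonormalBasisIndex rfl l hO :
      Module.End.Eigenvalues U.toLinearMap) : ℂ), fun l => ?_⟩
  have h1 := hI.subordinateOrthonormalBasis_subordinate rfl l hO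
  rw [Module.End.mem_eigenspace_iff] at h1
  have h2 : U (hI.subordinateOrthonormalBasis rfl hO l) =
    ((hI.subordinateOrthonormalBasisIndex rfl l hO : Module.End.Eigenvalues U.toLinearMap) : ℂ) •
      hI.subordinateOrthonormalBasis rfl hO l := h1
  exact ⟨U.norm_eigenvalue_eq_one ((OrthonormalBasis.orthonormal _).ne_zero l) h2, h2⟩

/-- Two families of vectors with the same Gram matrix differ by an isometry of the whole space: the
map between their spans that matches them is well defined and isometric, and it extends. -/
theorem exists_linearIsometry_apply_eq_of_inner_eq {ι : Type*} [Fintype ι] (p q : ι → V)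
    (h : ∀ i j, ⟪p i, p j⟫_ℂ = ⟪q i, q j⟫_ℂ) : ∃ U : V →ₗᵢ[ℂ] V, ∀ i, U (p i) = q i := by
  classical
  have hn : ∀ x : ι → ℂ, ‖Fintype.linearCombination ℂ p x‖ =
      ‖Fintype.linearCombination ℂ q x‖ := by
    intro x
    rw [@norm_eq_sqrt_re_inner ℂ, @norm_eq_sqrt_re_inner ℂ]
    simp only [Fintype.linearCombination_apply, inner_sum, sum_inner, inner_smul_left,
      inner_smul_right, h]
  have hker : LinearMap.ker (Fintype.linearCombination ℂ p) ≤
      LinearMap.ker (Fintype.linearCombination ℂ q) := by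
    intro x hx
    rw [LinearMap.mem_ker] at hx ⊢
    rw [← norm_eq_zero, ← hn, hx, norm_zero]
  let L : LinearMap.range (Fintype.linearCombination ℂ p) →ₗ[ℂ] V :=
    (LinearMap.ker (Fintype.linearCombination ℂ p)).liftQ _ hker ∘ₗ
      (Fintype.linearCombination ℂ p).quotKerEquivRange.symm.toLinearMap
  have hL : ∀ x, L ⟨Fintype.linearCombination ℂ p x, x, rfl⟩ = Fintype.linearCombination ℂ q x := by
    intro x
    have : (Fintype.linearCombination ℂ p).quotKerEquivRange.symm
        ⟨Fintype.linearCombination ℂ p x, x, rfl⟩ = Submodule.Quotient.mk x := by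
      rw [LinearEquiv.symm_apply_eq]; rfl
    simp only [L, LinearMap.comp_apply, LinearEquiv.coe_coe, this]
    rfl
  let L' : LinearMap.range (Fintype.linearCombination ℂ p) →ₗᵢ[ℂ] V :=
    { L with
      norm_map' := by
        rintro ⟨_, x, rfl⟩
        exact (congrArg norm (hL x)).trans (hn x).symm }
  refine ⟨L'.extend, fun i => ?_⟩
  have h1 : p i = Fintype.linearCombination ℂ p (Pi.single i 1) := by
    rw [Fintype.linearCombination_apply_single, one_smul]
  have h2 : q i = Fintype.linearCombination ℂ q (Pi.single i 1) := by
    rw [Fintype.linearCombination_apply_single, one_smul]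
  rw [h1, h2]
  exact (L'.extend_apply ⟨_, _, rfl⟩).trans (hL _)

/-- The complex form of the duality between the numerical radius and the block matrices
`[W, Y; Y*, W]`: here `W` is the common Gram matrix of `p` and `q`, the entries of `Y` are
`⟪p i, q j⟫`, and `a` is a matrix of numerical radius at most `1`. Expanding in an eigenbasis `b l`
of an isometry carrying `p` to `q` turns the left side into a sum of values of the form of `a`,
each multiplied by an eigenvalue of modulus one. -/
theorem re_sum_mul_inner_le_of_inner_eq {ι : Type*} [Fintype ι] (p q : ι → V)
    (h : ∀ i j, ⟪p i, p j⟫_ℂ = ⟪q i, q j⟫_ℂ) (a : ι → ι → ℂ)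
    (ha : ∀ x : ι → ℂ, ‖∑ i, ∑ j, conj (x i) * a i j * x j‖ ≤ ∑ i, ‖x i‖ ^ 2) :
    (∑ i, ∑ j, conj (a i j) * ⟪p i, q j⟫_ℂ).re ≤ ∑ i, ‖p i‖ ^ 2 := by
  obtain ⟨U, hU⟩ := exists_linearIsometry_apply_eq_of_inner_eq p q h
  obtain ⟨b, c, hb⟩ := U.exists_orthonormalBasis_eigenvectors
  have hpq : ∀ i j, ⟪p i, q j⟫_ℂ = ∑ l, c l * (⟪p i, b l⟫_ℂ * conj ⟪p j, b l⟫_ℂ) := by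
    intro i j
    have h1 : q j = ∑ l, ⟪b l, p j⟫_ℂ • c l • b l := by
      rw [← hU j]
      conv_lhs => rw [← b.sum_repr' (p j)]
      simp only [map_sum, map_smul, (hb _).2]
    rw [h1, inner_sum]
    refine Finset.sum_congr rfl fun l _ => ?_
    rw [inner_smul_right, inner_smul_right, inner_conj_symm]
    ring
  have hp : ∀ i, ‖p i‖ ^ 2 = ∑ l, ‖⟪p i, b l⟫_ℂ‖ ^ 2 := fun i =>
    (b.sum_sq_norm_inner_left (p i)).symm
  have key : ∑ i, ∑ j, conj (a i j) * ⟪p i, q j⟫_ℂ =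
      ∑ l, c l * conj (∑ i, ∑ j, conj ⟪p i, b l⟫_ℂ * a i j * ⟪p j, b l⟫_ℂ) := by
    simp only [hpq, map_sum, Finset.mul_sum, map_mul, Complex.conj_conj]
    calc _ = ∑ i, ∑ l, ∑ j, _ := Finset.sum_congr rfl fun i _ => Finset.sum_comm
      _ = _ := Finset.sum_comm
      _ = _ := Finset.sum_congr rfl fun l _ => Finset.sum_congr rfl fun i _ =>
        Finset.sum_congr rfl fun j _ => by ring
  rw [key, Finset.sum_congr rfl fun i _ => hp i, Finset.sum_comm, Complex.re_sum]
  refine Finset.sum_le_sum fun l _ => (Complex.re_le_norm _).trans ?_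
  rw [norm_mul, (hb l).1, one_mul, RCLike.norm_conj]
  exact ha _

end ComplexUnitary

/-! ### Quaternionic matrices as complex matrices -/

namespace Quaternion

theorem re_sum {ι : Type*} (s : Finset ι) (f : ι → ℍ[ℝ]) : (∑ i ∈ s, f i).re = ∑ i ∈ s, (f i).re :=
  map_sum (AddMonoidHom.mk' (fun q : ℍ[ℝ] => q.re) fun _ _ => rfl) f s

theorem re_mul_comm (a b : ℍ[ℝ]) : (a * b).re = (b * a).re := by
  simp only [re_mul]; ring

/-- The component in `ℂ` of a quaternion in the decomposition `ℍ = ℂ ⊕ jℂ`. -/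
def complexPart (q : ℍ[ℝ]) : ℂ := ⟨q.re, q.imI⟩

theorem complexPart_sum {ι : Type*} (s : Finset ι) (f : ι → ℍ[ℝ]) :
    complexPart (∑ i ∈ s, f i) = ∑ i ∈ s, complexPart (f i) :=
  map_sum (AddMonoidHom.mk' complexPart fun _ _ => rfl) f s

theorem norm_sq_eq (q : ℍ[ℝ]) : ‖q‖ ^ 2 = q.re ^ 2 + q.imI ^ 2 + q.imJ ^ 2 + q.imK ^ 2 := by
  rw [sq, ← normSq_eq_norm_mul_self, normSq_def']

theorem norm_complexPart_le (q : ℍ[ℝ]) : ‖complexPart q‖ ≤ ‖q‖ := by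
  refine le_of_sq_le_sq ?_ (norm_nonneg q)
  rw [norm_sq_eq, Complex.sq_norm, Complex.normSq_apply]
  simp only [complexPart]
  nlinarith [sq_nonneg q.imJ, sq_nonneg q.imK]

theorem re_le_norm (q : ℍ[ℝ]) : q.re ≤ ‖q‖ := by
  refine (le_abs_self _).trans (abs_le_of_sq_le_sq ?_ (norm_nonneg q))
  rw [norm_sq_eq]
  nlinarith [sq_nonneg q.imJ, sq_nonneg q.imK, sq_nonneg q.imI]

/-- The quaternion `u 0 + j (u 1)`. Since `j i = -k`, the imaginary part of `u 1` enters the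
`k`-component with a minus sign. -/
def ofPair (u : Fin 2 → ℂ) : ℍ[ℝ] := ⟨(u 0).re, (u 0).im, (u 1).re, -(u 1).im⟩

@[simp] theorem re_ofPair (u : Fin 2 → ℂ) : (ofPair u).re = (u 0).re := rfl
@[simp] theorem imI_ofPair (u : Fin 2 → ℂ) : (ofPair u).imI = (u 0).im := rfl
@[simp] theorem imJ_ofPair (u : Fin 2 → ℂ) : (ofPair u).imJ = (u 1).re := rfl
@[simp] theorem imK_ofPair (u : Fin 2 → ℂ) : (ofPair u).imK = -(u 1).im := rfl

theorem norm_ofPair_sq (u : Fin 2 → ℂ) : ‖ofPair u‖ ^ 2 = ∑ k, ‖u k‖ ^ 2 := by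
  rw [norm_sq_eq, Fin.sum_univ_two, Complex.sq_norm, Complex.sq_norm, Complex.normSq_apply,
    Complex.normSq_apply]
  simp only [ofPair]
  ring

/-- The matrix of left multiplication by `a` on `ℍ = ℂ ⊕ jℂ`, regarded as a right vector space
over `ℂ`, in the coordinates of `Quaternion.ofPair`. -/
def toComplexMatrix (a : ℍ[ℝ]) : Matrix (Fin 2) (Fin 2) ℂ :=
  !![⟨a.re, a.imI⟩, ⟨-a.imJ, -a.imK⟩; ⟨a.imJ, -a.imK⟩, ⟨a.re, -a.imI⟩]

theorem sum_conj_mul_toComplexMatrix_mul (a : ℍ[ℝ]) (u w : Fin 2 → ℂ) :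
    ∑ k, ∑ l, conj (u k) * toComplexMatrix a k l * w l =
      complexPart (star (ofPair u) * a * ofPair w) := by
  apply Complex.ext <;>
  simp [toComplexMatrix, Fin.sum_univ_two, complexPart] <;> ring

theorem toComplexMatrix_star (a : ℍ[ℝ]) (k l : Fin 2) :
    toComplexMatrix (star a) k l = conj (toComplexMatrix a l k) := by
  apply Complex.ext <;> fin_cases k <;> fin_cases l <;> simp [toComplexMatrix]

/-- The trace pairing of complex `2 × 2` matrices is twice the real pairing of quaternions. -/
theorem re_sum_conj_toComplexMatrix_mul (a b : ℍ[ℝ]) :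
    (∑ k, ∑ l, conj (toComplexMatrix a k l) * toComplexMatrix b k l).re = 2 * (star a * b).re := by
  simp [toComplexMatrix, Fin.sum_univ_two]
  ring

end Quaternion

open Quaternion

namespace Matrix

/-- The trace over the noncommutative ring `ℍ` is not cyclic, but its real part is. -/
theorem re_trace_mul_comm {m l : Type*} [Fintype m] [Fintype l] (A : Matrix m l ℍ[ℝ])
    (B : Matrix l m ℍ[ℝ]) : (A * B).trace.re = (B * A).trace.re := by
  simp only [trace, diag_apply, mul_apply, Quaternion.re_sum]
  rw [Finset.sum_comm]
  exact Finset.sum_congr rfl fun i _ => Finset.sum_congr rfl fun j _ => Quaternion.re_mul_comm _ _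

/-- The complex matrix of a quaternionic matrix acting on `ℍ^m = ℂ^m ⊕ jℂ^m`, with rows and
columns indexed by `m × Fin 2`. -/
def quaternionToComplex {m : Type*} (A : Matrix m m ℍ[ℝ]) : Matrix (m × Fin 2) (m × Fin 2) ℂ :=
  of fun p q => toComplexMatrix (A p.1 q.1) p.2 q.2

end Matrix

section Forms

variable {m : Type} [Fintype m]

theorem qForm_eq_sum (A : Matrix m m ℍ[ℝ]) (x : m → ℍ[ℝ]) :
    qForm A x = ∑ i, ∑ j, star (x i) * A i j * x j := by
  simp only [qForm, dotProduct, Matrix.mulVec, Finset.mul_sum, Pi.star_apply, mul_assoc]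

theorem Matrix.IsHermitian.star_qForm {A : Matrix m m ℍ[ℝ]} (hA : A.IsHermitian) (x : m → ℍ[ℝ]) :
    star (qForm A x) = qForm A x := by
  simp only [qForm_eq_sum, star_sum, star_mul, star_star]
  rw [Finset.sum_comm]
  refine Finset.sum_congr rfl fun i _ => Finset.sum_congr rfl fun j _ => ?_
  rw [hA.apply, mul_assoc]

/-- The form of the associated complex matrix is the complex part of the quaternionic form. Hence
its numerical radius is at most that of the quaternionic matrix. -/
theorem sum_conj_mul_quaternionToComplex_mul (A : Matrix m m ℍ[ℝ]) (x : m × Fin 2 → ℂ) :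
    ∑ p, ∑ q, conj (x p) * A.quaternionToComplex p q * x q =
      complexPart (qForm A fun i => ofPair fun k => x (i, k)) := by
  simp only [qForm_eq_sum, complexPart_sum, ← sum_conj_mul_toComplexMatrix_mul,
    Fintype.sum_prod_type]
  refine Finset.sum_congr rfl fun i _ => ?_
  exact Finset.sum_comm

open scoped ComplexOrder in
theorem QPosSemidef.quaternionToComplex {A : Matrix m m ℍ[ℝ]} (hA : QPosSemidef A) :
    A.quaternionToComplex.PosSemidef := by
  refine Matrix.PosSemidef.of_dotProduct_mulVec_nonneg ?_ fun x => ?_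
  · ext p q
    simp only [Matrix.quaternionToComplex, Matrix.conjTranspose_apply, Matrix.of_apply]
    rw [← hA.1.apply p.1 q.1, toComplexMatrix_star]
    rfl
  · have h1 : star x ⬝ᵥ (A.quaternionToComplex.mulVec x) =
        complexPart (qForm A fun i => ofPair fun k => x (i, k)) := by
      rw [← sum_conj_mul_quaternionToComplex_mul]
      simp only [dotProduct, Matrix.mulVec, Finset.mul_sum, Pi.star_apply, mul_assoc]
      rfl
    rw [h1, Complex.le_def]
    refine ⟨hA.2 _, ?_⟩
    have h2 := congrArg QuaternionAlgebra.imI (hA.1.star_qForm fun i => ofPair fun k => x (i, k))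
    rw [Quaternion.imI_star] at h2
    simp only [complexPart, Complex.zero_im]
    linarith

theorem re_sum_conj_quaternionToComplex_mul (A B : Matrix m m ℍ[ℝ]) :
    (∑ p, ∑ q, conj (A.quaternionToComplex p q) * B.quaternionToComplex p q).re =
      2 * (A.conjTranspose * B).trace.re := by
  have h : ∑ p, ∑ q, conj (A.quaternionToComplex p q) * B.quaternionToComplex p q =
      ∑ i, ∑ j, ∑ k, ∑ l, conj (toComplexMatrix (A i j) k l) * toComplexMatrix (B i j) k l := by
    simp only [Fintype.sum_prod_type]
    refine Finset.sum_congr rfl fun i _ => ?_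
    exact Finset.sum_comm
  rw [h]
  simp only [Complex.re_sum (Finset.univ : Finset m), re_sum_conj_toComplexMatrix_mul]
  simp only [Matrix.trace, Matrix.diag_apply, Matrix.mul_apply, Quaternion.re_sum,
    Matrix.conjTranspose_apply, Finset.mul_sum]
  exact Finset.sum_comm

end Forms

/-! ### The numerical radius -/

section NumRadius

variable {n : ℕ}

/-- A crude bound, which makes the supremum defining `qNumRadius` a genuine one and shows that the
identity is an order unit of the positive semidefinite cone. -/
theorem norm_qForm_le_sum {m : Type} [Fintype m] (A : Matrix m m ℍ[ℝ]) (x : m → ℍ[ℝ]) :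
    ‖qForm A x‖ ≤ (∑ i, ∑ j, ‖A i j‖) * ∑ i, ‖x i‖ ^ 2 := by
  have h1 : ∀ i, ‖x i‖ ^ 2 ≤ ∑ i, ‖x i‖ ^ 2 := fun i =>
    Finset.single_le_sum (f := fun i => ‖x i‖ ^ 2) (fun _ _ => sq_nonneg _) (Finset.mem_univ i)
  rw [qForm_eq_sum, Finset.sum_mul]
  refine (norm_sum_le _ _).trans (Finset.sum_le_sum fun i _ => ?_)
  rw [Finset.sum_mul]
  refine (norm_sum_le _ _).trans (Finset.sum_le_sum fun j _ => ?_)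
  rw [norm_mul, norm_mul, norm_star]
  calc ‖x i‖ * ‖A i j‖ * ‖x j‖ = ‖A i j‖ * (‖x i‖ * ‖x j‖) := by ring
    _ ≤ ‖A i j‖ * ∑ i, ‖x i‖ ^ 2 := by
      gcongr
      nlinarith [h1 i, h1 j, sq_nonneg (‖x i‖ - ‖x j‖)]

theorem qForm_smul {m : Type} [Fintype m] (A : Matrix m m ℍ[ℝ]) (c : ℝ) (x : m → ℍ[ℝ]) :
    qForm A (c • x) = c ^ 2 • qForm A x := by
  simp only [qForm_eq_sum, Finset.smul_sum, Pi.smul_apply]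
  refine Finset.sum_congr rfl fun i _ => Finset.sum_congr rfl fun j _ => ?_
  simp [smul_smul, sq]

theorem norm_qForm_le (A : Matrix (Fin n) (Fin n) ℍ[ℝ]) (x : Fin n → ℍ[ℝ]) :
    ‖qForm A x‖ ≤ qNumRadius A * ∑ i, ‖x i‖ ^ 2 := by
  set r := ∑ i, ‖x i‖ ^ 2 with hr
  have hr0 : 0 ≤ r := Finset.sum_nonneg fun _ _ => sq_nonneg _
  rcases hr0.eq_or_lt with h0 | hpos
  -- The vector `0` cannot be normalized; there both sides vanish.
  · have : x = 0 := by
      funext i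
      have := (Finset.sum_eq_zero_iff_of_nonneg (fun i _ => sq_nonneg ‖x i‖)).1 h0.symm i
        (Finset.mem_univ i)
      simpa using this
    simp [← h0, this, qForm]
  · set c := (Real.sqrt r)⁻¹ with hc
    have hc2 : c ^ 2 = r⁻¹ := by rw [hc, inv_pow, Real.sq_sqrt hr0]
    have h1 : ∑ i, ‖(c • x) i‖ ^ 2 = 1 := by
      simp only [Pi.smul_apply, norm_smul, mul_pow, Real.norm_eq_abs, sq_abs, ← Finset.mul_sum]
      rw [hc2, ← hr, inv_mul_cancel₀ hpos.ne']
    have hb : BddAbove {t : ℝ | ∃ x : Fin n → ℍ[ℝ], ∑ i, ‖x i‖ ^ 2 = 1 ∧ t = ‖qForm A x‖} :=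
      ⟨∑ i, ∑ j, ‖A i j‖, by
        rintro t ⟨y, hy, rfl⟩
        simpa [hy] using norm_qForm_le_sum A y⟩
    have h2 : ‖qForm A (c • x)‖ ≤ qNumRadius A := le_csSup hb ⟨_, h1, rfl⟩
    rw [qForm_smul, norm_smul, hc2, Real.norm_eq_abs, abs_of_pos (inv_pos.2 hpos),
      inv_mul_le_iff₀ hpos] at h2
    linarith

theorem qNumRadius_le {A : Matrix (Fin n) (Fin n) ℍ[ℝ]} {r : ℝ} (hr : 0 ≤ r)
    (h : ∀ x : Fin n → ℍ[ℝ], ∑ i, ‖x i‖ ^ 2 = 1 → ‖qForm A x‖ ≤ r) : qNumRadius A ≤ r :=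
  Real.sSup_le (by rintro t ⟨x, hx, rfl⟩; exact h x hx) hr

open scoped ComplexOrder MatrixOrder in
/-- Weak duality between the numerical radius and its dual norm. The complex matrix of
`[V, Y; Y*, V]` is a Gram matrix, its two diagonal blocks agree, and its trace pairings are twice
the real quaternionic ones. -/
theorem re_trace_conjTranspose_mul_le {A V Y : Matrix (Fin n) (Fin n) ℍ[ℝ]}
    (hA : qNumRadius A ≤ 1) (hV : QPosSemidef (Matrix.fromBlocks V Y Y.conjTranspose V)) :
    (A.conjTranspose * Y).trace.re ≤ V.trace.re := by
  obtain ⟨G, hG⟩ := CStarAlgebra.nonneg_iff_eq_star_mul_self.mp hV.quaternionToComplex.nonneg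
  have hG' : ∀ p q, ⟪WithLp.toLp 2 fun r => G r p, WithLp.toLp 2 fun r => G r q⟫_ℂ =
      (Matrix.fromBlocks V Y Y.conjTranspose V).quaternionToComplex p q := by
    intro p q
    rw [hG, PiLp.inner_apply, Matrix.mul_apply]
    refine Finset.sum_congr rfl fun r _ => ?_
    simp [Matrix.star_apply, mul_comm]
  have key := re_sum_mul_inner_le_of_inner_eq (ι := Fin n × Fin 2)
    (V := EuclideanSpace ℂ ((Fin n ⊕ Fin n) × Fin 2))
    (fun p => WithLp.toLp 2 fun r => G r (Sum.inl p.1, p.2))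
    (fun p => WithLp.toLp 2 fun r => G r (Sum.inr p.1, p.2))
    (fun p q => by rw [hG', hG']; rfl) A.quaternionToComplex (fun x => by
      rw [sum_conj_mul_quaternionToComplex_mul]
      refine (norm_complexPart_le _).trans ((norm_qForm_le A _).trans ?_)
      rw [Fintype.sum_prod_type]
      simp only [norm_ofPair_sq]
      exact mul_le_of_le_one_left (Finset.sum_nonneg fun _ _ =>
        Finset.sum_nonneg fun _ _ => sq_nonneg _) hA)
  have hY : ∑ p : Fin n × Fin 2, ∑ q : Fin n × Fin 2, conj (A.quaternionToComplex p q) *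
      ⟪WithLp.toLp 2 fun r => G r (Sum.inl p.1, p.2),
        WithLp.toLp 2 fun r => G r (Sum.inr q.1, q.2)⟫_ℂ =
      ∑ p, ∑ q, conj (A.quaternionToComplex p q) * Y.quaternionToComplex p q :=
    Finset.sum_congr rfl fun p _ => Finset.sum_congr rfl fun q _ => by rw [hG']; rfl
  have hW : ∑ p : Fin n × Fin 2, ‖WithLp.toLp 2 fun r => G r (Sum.inl p.1, p.2)‖ ^ 2 =
      2 * V.trace.re := by
    simp only [@norm_sq_eq_re_inner ℂ, hG', Fintype.sum_prod_type, Matrix.trace, Quaternion.re_sum,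
      Finset.mul_sum, Fin.sum_univ_two]
    refine Finset.sum_congr rfl fun i _ => ?_
    simp [Matrix.quaternionToComplex, toComplexMatrix]
    ring
  rw [hY, re_sum_conj_quaternionToComplex_mul, hW] at key
  linarith

end NumRadius

/-! ### The cone of positive semidefinite quaternionic matrices -/

section Cone

variable {m : Type} [Fintype m]

theorem qForm_add_left (A B : Matrix m m ℍ[ℝ]) (x : m → ℍ[ℝ]) :
    qForm (A + B) x = qForm A x + qForm B x := by
  simp only [qForm, Matrix.add_mulVec, dotProduct_add]

theorem qForm_smul_left (c : ℝ) (A : Matrix m m ℍ[ℝ]) (x : m → ℍ[ℝ]) :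
    qForm (c • A) x = c • qForm A x := by
  simp only [qForm, Matrix.smul_mulVec, dotProduct_smul]

theorem qForm_one [DecidableEq m] (x : m → ℍ[ℝ]) :
    (qForm (1 : Matrix m m ℍ[ℝ]) x).re = ∑ i, ‖x i‖ ^ 2 := by
  simp only [qForm, Matrix.one_mulVec, dotProduct, Quaternion.re_sum, Pi.star_apply]
  refine Finset.sum_congr rfl fun i _ => ?_
  rw [Quaternion.star_mul_self, Quaternion.re_coe, Quaternion.normSq_eq_norm_mul_self, sq]

theorem QPosSemidef.add {A B : Matrix m m ℍ[ℝ]} (hA : QPosSemidef A) (hB : QPosSemidef B) :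
    QPosSemidef (A + B) :=
  ⟨hA.1.add hB.1, fun x => by
    rw [qForm_add_left, re_add]; exact add_nonneg (hA.2 x) (hB.2 x)⟩

theorem QPosSemidef.smul {A : Matrix m m ℍ[ℝ]} (hA : QPosSemidef A) {c : ℝ} (hc : 0 ≤ c) :
    QPosSemidef (c • A) :=
  ⟨(QHerm m).smul_mem c hA.1, fun x => by
    rw [qForm_smul_left, Quaternion.re_smul]; exact mul_nonneg hc (hA.2 x)⟩

theorem qPosSemidef_zero : QPosSemidef (0 : Matrix m m ℍ[ℝ]) :=
  ⟨Matrix.isHermitian_zero, fun x => by simp [qForm]⟩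

theorem Matrix.IsHermitian.exists_qPosSemidef_smul_one_add [DecidableEq m] {A : Matrix m m ℍ[ℝ]}
    (hA : A.IsHermitian) : ∃ c : ℝ, QPosSemidef (c • 1 + A) := by
  refine ⟨∑ i, ∑ j, ‖A i j‖,
    ((QHerm m).smul_mem _ Matrix.isHermitian_one).add hA, fun x => ?_⟩
  rw [qForm_add_left, re_add, qForm_smul_left, Quaternion.re_smul, qForm_one, smul_eq_mul]
  have h1 := norm_qForm_le_sum A x
  have h2 := Quaternion.re_le_norm (-qForm A x)
  rw [norm_neg, Quaternion.re_neg] at h2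
  linarith

theorem re_qForm_vecMulVec_star_nonneg (x y : m → ℍ[ℝ]) :
    0 ≤ (qForm (Matrix.vecMulVec x (star x)) y).re := by
  have h : qForm (Matrix.vecMulVec x (star x)) y = (star y ⬝ᵥ x) * star (star y ⬝ᵥ x) := by
    simp only [qForm_eq_sum, Matrix.vecMulVec_apply, dotProduct, star_sum, star_mul, star_star,
      Finset.sum_mul_sum, Pi.star_apply, mul_assoc]
  rw [h, Quaternion.self_mul_star, Quaternion.re_coe]
  exact Quaternion.normSq_nonneg

theorem qPosSemidef_vecMulVec_star (x : m → ℍ[ℝ]) : QPosSemidef (Matrix.vecMulVec x (star x)) := by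
  refine ⟨?_, re_qForm_vecMulVec_star_nonneg x⟩
  ext i j : 1
  simp [Matrix.conjTranspose_apply, Matrix.vecMulVec_apply]

theorem re_trace_vecMulVec_star_mul (x : m → ℍ[ℝ]) (Z : Matrix m m ℍ[ℝ]) :
    (Matrix.vecMulVec x (star x) * Z).trace.re = (qForm Z x).re := by
  simp only [qForm_eq_sum, Matrix.trace, Matrix.diag_apply, Matrix.mul_apply, Quaternion.re_sum,
    Matrix.vecMulVec_apply, Pi.star_apply]
  rw [Finset.sum_comm]
  refine Finset.sum_congr rfl fun i _ => Finset.sum_congr rfl fun j _ => ?_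
  rw [mul_assoc, Quaternion.re_mul_comm]

theorem re_trace_vecMulVec_star (x : m → ℍ[ℝ]) :
    (Matrix.vecMulVec x (star x)).trace.re = ∑ i, ‖x i‖ ^ 2 := by
  simp only [Matrix.trace, Matrix.diag_apply, Quaternion.re_sum, Matrix.vecMulVec_apply,
    Pi.star_apply]
  refine Finset.sum_congr rfl fun i _ => ?_
  rw [Quaternion.self_mul_star, Quaternion.re_coe, Quaternion.normSq_eq_norm_mul_self, sq]

theorem qForm_single [DecidableEq m] (A : Matrix m m ℍ[ℝ]) (i : m) :
    qForm A (Pi.single i 1) = A i i := by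
  rw [qForm, ← Pi.single_star]
  simp

theorem qForm_single_add_single [DecidableEq m] (A : Matrix m m ℍ[ℝ]) (i j : m) (u : ℍ[ℝ]) :
    qForm A (Pi.single i 1 + Pi.single j u) =
      A i i + A i j * u + star u * A j i + star u * A j j * u := by
  rw [qForm, star_add, ← Pi.single_star, ← Pi.single_star]
  simp [Matrix.mulVec_add, mul_assoc]
  abel

/-- Right multiplication by a unit quaternion rotates `b` onto the negative real axis. -/
theorem Quaternion.exists_norm_one_mul_eq (b : ℍ[ℝ]) : ∃ u : ℍ[ℝ], ‖u‖ = 1 ∧ (b * u).re = -‖b‖ := by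
  by_cases hb : b = 0
  · exact ⟨1, by simp, by simp [hb]⟩
  have h0 : ‖b‖ ≠ 0 := norm_ne_zero_iff.2 hb
  refine ⟨-(‖b‖⁻¹ • star b), ?_, ?_⟩
  · rw [norm_neg, norm_smul, norm_star, norm_inv, norm_norm, inv_mul_cancel₀ h0]
  · rw [mul_neg, mul_smul_comm, Quaternion.self_mul_star, Quaternion.re_neg, Quaternion.re_smul,
      Quaternion.re_coe, Quaternion.normSq_eq_norm_mul_self, smul_eq_mul, inv_mul_cancel_left₀ h0]

theorem Quaternion.re_star_mul_mul (u q : ℍ[ℝ]) : (star u * q * u).re = ‖u‖ ^ 2 * q.re := by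
  rw [Quaternion.re_mul_comm, ← mul_assoc, Quaternion.self_mul_star, Quaternion.coe_mul_eq_smul,
    Quaternion.re_smul, Quaternion.normSq_eq_norm_mul_self, sq, smul_eq_mul]

theorem QPosSemidef.re_diag_nonneg {A : Matrix m m ℍ[ℝ]} (hA : QPosSemidef A) (i : m) :
    0 ≤ (A i i).re := by
  classical
  rw [← qForm_single A i]; exact hA.2 _

theorem QPosSemidef.re_trace_nonneg {A : Matrix m m ℍ[ℝ]} (hA : QPosSemidef A) :
    0 ≤ A.trace.re := by
  rw [Matrix.trace, Quaternion.re_sum]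
  exact Finset.sum_nonneg fun i _ => hA.re_diag_nonneg i

/-- Every entry is bounded by the trace: evaluate the form at `e_i + e_j u`, with `u` a unit
quaternion rotating `A i j` onto the negative real axis. -/
theorem QPosSemidef.norm_apply_le {A : Matrix m m ℍ[ℝ]} (hA : QPosSemidef A) (i j : m) :
    ‖A i j‖ ≤ A.trace.re := by
  classical
  have hle : ∀ i, (A i i).re ≤ A.trace.re := fun i => by
    rw [Matrix.trace, Quaternion.re_sum]
    exact Finset.single_le_sum (f := fun i => (A i i).re) (fun i _ => hA.re_diag_nonneg i)
      (Finset.mem_univ i)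
  obtain ⟨u, hu, hu'⟩ := Quaternion.exists_norm_one_mul_eq (A i j)
  have h := hA.2 (Pi.single i 1 + Pi.single j u)
  have hs : (star u * A j i).re = (A i j * u).re := by
    rw [← hA.1.apply j i, ← star_mul, Quaternion.re_star]
  rw [qForm_single_add_single, re_add, re_add, re_add, hs, hu', Quaternion.re_star_mul_mul, hu] at h
  linarith [hle i, hle j]

theorem Matrix.IsHermitian.trace_eq_coe {A : Matrix m m ℍ[ℝ]} (hA : A.IsHermitian) :
    A.trace = (A.trace.re : ℍ[ℝ]) := by
  have h : star A.trace = A.trace := by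
    rw [← Matrix.trace_conjTranspose, hA.eq]
  exact Quaternion.star_eq_self.1 h

theorem isClosed_setOf_qPosSemidef : IsClosed {A : Matrix m m ℍ[ℝ] | QPosSemidef A} := by
  simp only [QPosSemidef, Set.ofPred_and, Set.ofPred_forall]
  refine IsClosed.inter ?_ (isClosed_iInter fun x => ?_)
  · exact isClosed_eq (continuous_id.matrix_conjTranspose) continuous_id
  · refine isClosed_le continuous_const (Quaternion.continuous_re.comp ?_)
    exact continuous_const.dotProduct (continuous_id.matrix_mulVec continuous_const)

/-- The trace of a selfadjoint quaternionic matrix, which is real, as a real linear functional. -/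
noncomputable def qTrace (m : Type) [Fintype m] : QHerm m →ₗ[ℝ] ℝ where
  toFun A := (A : Matrix m m ℍ[ℝ]).trace.re
  map_add' A B := by simp [Matrix.trace_add]
  map_smul' c A := by simp [Matrix.trace_smul]

/-- Riesz representation on `H_m(ℍ)` for the pairing `(X, Z) ↦ Re tr (X Z)`. -/
theorem exists_eq_re_trace_mul (F : QHerm m →ₗ[ℝ] ℝ) :
    ∃ Z : Matrix m m ℍ[ℝ], Z.IsHermitian ∧
      ∀ X : QHerm m, F X = ((X : Matrix m m ℍ[ℝ]) * Z).trace.re := by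
  classical
  obtain ⟨G, hG⟩ := F.exists_extend
  let z : m → m → ℍ[ℝ] := fun i j => (InnerProductSpace.toDual ℝ ℍ[ℝ]).symm
    (G ∘ₗ Matrix.singleLinearMap ℝ i j).toContinuousLinearMap
  have hz : ∀ i j q, G (Matrix.single i j q) = (q * star (z i j)).re := by
    intro i j q
    rw [← Quaternion.inner_def, real_inner_comm, InnerProductSpace.toDual_symm_apply]
    rfl
  let Z : Matrix m m ℍ[ℝ] := Matrix.of fun j i => star (z i j)
  have hZ : ∀ X : Matrix m m ℍ[ℝ], G X = (X * Z).trace.re := by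
    intro X
    conv_lhs => rw [Matrix.matrix_eq_sum_single X]
    simp only [map_sum, hz, Matrix.trace, Matrix.diag_apply, Matrix.mul_apply, Quaternion.re_sum]
    rfl
  have hZ' : ∀ X : QHerm m, ((X : Matrix m m ℍ[ℝ]) * Z.conjTranspose).trace.re =
      ((X : Matrix m m ℍ[ℝ]) * Z).trace.re := by
    intro X
    have hX : (X : Matrix m m ℍ[ℝ]).conjTranspose = X := X.2
    have : (X : Matrix m m ℍ[ℝ]) * Z.conjTranspose =
        (Z * (X : Matrix m m ℍ[ℝ])).conjTranspose := by rw [Matrix.conjTranspose_mul, hX]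
    rw [this, Matrix.trace_conjTranspose, Quaternion.re_star, Matrix.re_trace_mul_comm]
  -- The functional only sees selfadjoint `X`, so its representative may be symmetrized.
  refine ⟨(1 / 2 : ℝ) • (Z + Z.conjTranspose),
    (QHerm m).smul_mem _ (Matrix.isHermitian_add_transpose_self Z), fun X => ?_⟩
  have hFG : F X = G X := (LinearMap.congr_fun hG X).symm
  rw [Matrix.mul_smul, Matrix.trace_smul, Quaternion.re_smul, Matrix.mul_add, Matrix.trace_add,
    re_add, hZ', hFG, hZ, smul_eq_mul]
  ring

end Cone

/-! ### Block matrices and attainment of the minimum -/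

section Blocks

variable {n : ℕ}

theorem qForm_fromBlocks {k l : Type} [Fintype k] [Fintype l] (A : Matrix k k ℍ[ℝ])
    (B : Matrix k l ℍ[ℝ]) (C : Matrix l k ℍ[ℝ]) (D : Matrix l l ℍ[ℝ]) (x : k → ℍ[ℝ])
    (y : l → ℍ[ℝ]) : qForm (Matrix.fromBlocks A B C D) (Sum.elim x y) =
      qForm A x + star x ⬝ᵥ B.mulVec y + star y ⬝ᵥ C.mulVec x + qForm D y := by
  have : star (Sum.elim x y) = Sum.elim (star x) (star y) := by
    ext (i | i) <;> rfl
  rw [qForm, Matrix.fromBlocks_mulVec, this, sumElim_dotProduct_sumElim]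
  simp only [Sum.elim_comp_inl, Sum.elim_comp_inr, dotProduct_add, qForm]
  abel

theorem Matrix.conjTranspose_real_smul {k l : Type*} (c : ℝ) (B : Matrix k l ℍ[ℝ]) :
    (c • B).conjTranspose = c • B.conjTranspose := by
  ext i j : 1
  simp [Matrix.conjTranspose_apply]

theorem Matrix.trace_fromBlocks {R k l : Type*} [AddCommMonoid R] [Fintype k] [Fintype l]
    (A : Matrix k k R) (B : Matrix k l R) (C : Matrix l k R) (D : Matrix l l R) :
    (Matrix.fromBlocks A B C D).trace = A.trace + D.trace := by
  simp [Matrix.trace, Fintype.sum_sum_type]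

/-- Conjugation by `diag(1, -1)`. -/
theorem qPosSemidef_fromBlocks_neg {V Y : Matrix (Fin n) (Fin n) ℍ[ℝ]}
    (h : QPosSemidef (Matrix.fromBlocks V Y Y.conjTranspose V)) :
    QPosSemidef (Matrix.fromBlocks V (-Y) (-Y).conjTranspose V) := by
  have hV := (Matrix.isHermitian_fromBlocks_iff.1 h.1).1
  refine ⟨Matrix.IsHermitian.fromBlocks hV rfl hV, fun z => ?_⟩
  have h1 := h.2 (Sum.elim (z ∘ Sum.inl) (-(z ∘ Sum.inr)))
  rw [← Sum.elim_comp_inl_inr z, qForm_fromBlocks]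
  rw [qForm_fromBlocks] at h1
  simpa [qForm, Matrix.neg_mulVec, Matrix.mulVec_neg] using h1

theorem qPosSemidef_fromBlocks_abs {V Y : Matrix (Fin n) (Fin n) ℍ[ℝ]} {t : ℝ}
    (h : QPosSemidef (Matrix.fromBlocks V (t • Y) (t • Y).conjTranspose V)) :
    QPosSemidef (Matrix.fromBlocks V (|t| • Y) (|t| • Y).conjTranspose V) := by
  rcases abs_choice t with ht | ht <;> rw [ht]
  · exact h
  · rw [neg_smul]; exact qPosSemidef_fromBlocks_neg h

/-- The map `W ↦ diag(W, W)` as a real linear map. -/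
noncomputable def qDiagLinear (n : ℕ) : QHerm (Fin n) →ₗ[ℝ] QHerm (Fin n ⊕ Fin n) where
  toFun := qDiag
  map_add' A B := Subtype.ext (by simp [qDiag, Matrix.fromBlocks_add])
  map_smul' c A := Subtype.ext (by simp [qDiag, Matrix.fromBlocks_smul])

theorem qDiagLinear_injective (n : ℕ) : Function.Injective (qDiagLinear n) := by
  intro A B h
  have := congrArg (fun X : QHerm (Fin n ⊕ Fin n) =>
    (X : Matrix (Fin n ⊕ Fin n) (Fin n ⊕ Fin n) ℍ[ℝ]).toBlocks₁₁) h
  exact Subtype.ext (by simpa [qDiagLinear, qDiag] using this)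

theorem qDiag_add_smul_qH (W : QHerm (Fin n)) (t : ℝ) (Y : Matrix (Fin n) (Fin n) ℍ[ℝ]) :
    ((qDiag W + t • qH Y : QHerm (Fin n ⊕ Fin n)) : Matrix _ _ ℍ[ℝ]) =
      Matrix.fromBlocks (W : Matrix (Fin n) (Fin n) ℍ[ℝ]) (t • Y) (t • Y).conjTranspose W := by
  simp [qDiag, qH, Matrix.fromBlocks_add, Matrix.fromBlocks_smul,
    Matrix.conjTranspose_real_smul]

/-- The minimum of the trace over the matrices `V` with `[V, Y; Y*, V] ⪰ 0` is attained, because the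
trace bounds all entries and its sublevel sets are therefore compact. -/
theorem exists_forall_re_trace_le (Y : Matrix (Fin n) (Fin n) ℍ[ℝ]) :
    ∃ V : Matrix (Fin n) (Fin n) ℍ[ℝ],
      QPosSemidef (Matrix.fromBlocks V Y Y.conjTranspose V) ∧
      ∀ V' : Matrix (Fin n) (Fin n) ℍ[ℝ],
        QPosSemidef (Matrix.fromBlocks V' Y Y.conjTranspose V') → V.trace.re ≤ V'.trace.re := by
  obtain ⟨c, hc⟩ := (qH Y).2.exists_qPosSemidef_smul_one_add
  set V₀ : Matrix (Fin n) (Fin n) ℍ[ℝ] := c • 1 with hV₀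
  have hfeas : QPosSemidef (Matrix.fromBlocks V₀ Y Y.conjTranspose V₀) := by
    convert hc using 1
    simp [qH, ← Matrix.fromBlocks_one, Matrix.fromBlocks_smul, Matrix.fromBlocks_add, hV₀]
  set S : Set (Matrix (Fin n) (Fin n) ℍ[ℝ]) :=
    {V | QPosSemidef (Matrix.fromBlocks V Y Y.conjTranspose V) ∧ V.trace.re ≤ V₀.trace.re} with hS
  have htr : Continuous fun V : Matrix (Fin n) (Fin n) ℍ[ℝ] => V.trace.re :=
    Quaternion.continuous_re.comp continuous_id.matrix_trace
  have hclosed : IsClosed S := by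
    refine IsClosed.inter ?_ (isClosed_le htr continuous_const)
    exact isClosed_setOf_qPosSemidef.preimage
      (continuous_id.matrix_fromBlocks continuous_const continuous_const continuous_id)
  have hcpt : IsCompact S := by
    refine IsCompact.of_isClosed_subset (isCompact_univ_pi fun i : Fin n =>
      isCompact_univ_pi fun j : Fin n => isCompact_closedBall (0 : ℍ[ℝ]) (2 * V₀.trace.re))
      hclosed ?_
    rintro V ⟨hV, hVtr⟩ i - j -
    have h1 := hV.norm_apply_le (Sum.inl i) (Sum.inl j)
    rw [Matrix.trace_fromBlocks, Matrix.fromBlocks_apply₁₁, re_add] at h1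
    rw [mem_closedBall_zero_iff]
    linarith
  obtain ⟨V, hV, hmin⟩ := hcpt.exists_isMinOn ⟨V₀, hfeas, le_rfl⟩ htr.continuousOn
  refine ⟨V, hV.1, fun V' hV' => ?_⟩
  by_cases h : V'.trace.re ≤ V₀.trace.re
  · exact hmin ⟨hV', h⟩
  · exact hV.2.trans (not_le.1 h).le

end Blocks

/-! ### Strong duality -/

section Duality

variable {n : ℕ}

/-- Strong duality with attainment in the dual. On pairs `(X, t)`, consider the cone of those with
`X + t H(Y) ⪰ 0`. Minimality of `tr V` says that `(diag(W, W), t) ↦ tr W - t tr V` is nonnegative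
on the part of its domain in this cone. A nonnegative extension exists by the theorem of M. Riesz,
and its restriction to the pairs `(X, 0)` is represented by the dual solution `Z`. -/
theorem exists_dual_of_forall_re_trace_le {V Y : Matrix (Fin n) (Fin n) ℍ[ℝ]}
    (hV : QPosSemidef (Matrix.fromBlocks V Y Y.conjTranspose V))
    (hmin : ∀ V' : Matrix (Fin n) (Fin n) ℍ[ℝ],
      QPosSemidef (Matrix.fromBlocks V' Y Y.conjTranspose V') → V.trace.re ≤ V'.trace.re) :
    ∃ Z : Matrix (Fin n ⊕ Fin n) (Fin n ⊕ Fin n) ℍ[ℝ], QPosSemidef Z ∧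
      (∀ W : QHerm (Fin n), ((qDiag W : Matrix (Fin n ⊕ Fin n) (Fin n ⊕ Fin n) ℍ[ℝ]) * Z).trace.re =
        (W : Matrix (Fin n) (Fin n) ℍ[ℝ]).trace.re) ∧
      (-(qH Y : Matrix (Fin n ⊕ Fin n) (Fin n ⊕ Fin n) ℍ[ℝ]) * Z).trace.re = V.trace.re := by
  -- The real coordinate keeps `t` independent of the matrix, so that the functional is well defined
  -- also for `Y = 0`.
  let s : PointedCone ℝ (QHerm (Fin n ⊕ Fin n) × ℝ) :=
    { carrier := {p | QPosSemidef (p.1 + p.2 • qH Y : QHerm (Fin n ⊕ Fin n)).1}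
      zero_mem' := by simpa using qPosSemidef_zero
      add_mem' := fun {p q} hp hq => by
        have h : (p + q).1 + (p + q).2 • qH Y = (p.1 + p.2 • qH Y) + (q.1 + q.2 • qH Y) := by
          rw [Prod.fst_add, Prod.snd_add, add_smul]; abel
        rw [Set.mem_ofPred_eq, h]
        exact QPosSemidef.add hp hq
      smul_mem' := fun c p hp => by
        have h : (c • p).1 + (c • p).2 • qH Y = (c : ℝ) • (p.1 + p.2 • qH Y) := by
          rw [smul_add, smul_smul]; rfl
        rw [Set.mem_ofPred_eq, h]
        exact QPosSemidef.smul hp c.2 }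
  let L : (QHerm (Fin n) × ℝ) →ₗ[ℝ] QHerm (Fin n ⊕ Fin n) × ℝ :=
    (qDiagLinear n).prodMap LinearMap.id
  have hL : Function.Injective L :=
    Prod.map_injective.2 ⟨qDiagLinear_injective n, Function.injective_id⟩
  let φ : (QHerm (Fin n) × ℝ) →ₗ[ℝ] ℝ :=
    (qTrace (Fin n)).coprod (LinearMap.lsmul ℝ ℝ (-V.trace.re))
  have hφ : ∀ W t, φ (W, t) = (W : Matrix (Fin n) (Fin n) ℍ[ℝ]).trace.re - V.trace.re * t := by
    intro W t
    simp [φ, qTrace, sub_eq_add_neg]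
  let f : (QHerm (Fin n ⊕ Fin n) × ℝ) →ₗ.[ℝ] ℝ :=
    ⟨LinearMap.range L, φ ∘ₗ (LinearEquiv.ofInjective L hL).symm.toLinearMap⟩
  have hf : ∀ w, f ⟨L w, w, rfl⟩ = φ w := by
    intro w
    have : (LinearEquiv.ofInjective L hL).symm ⟨L w, w, rfl⟩ = w := by
      rw [LinearEquiv.symm_apply_eq]; rfl
    exact congrArg φ this
  have hN : 0 ≤ V.trace.re := by
    have := hV.re_trace_nonneg
    rw [Matrix.trace_fromBlocks, re_add] at this
    linarith
  obtain ⟨g, hg, hgs⟩ := riesz_extension s f (by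
    rintro ⟨_, ⟨W, t⟩, rfl⟩ hx
    rw [hf, hφ, sub_nonneg]
    have hx' : QPosSemidef (qDiag W + t • qH Y : QHerm (Fin n ⊕ Fin n)).1 := hx
    rw [qDiag_add_smul_qH] at hx'
    have habs := qPosSemidef_fromBlocks_abs hx'
    refine (mul_le_mul_of_nonneg_left (le_abs_self t) hN).trans ?_
    rcases (abs_nonneg t).eq_or_lt with h0 | hpos
    · have := hx'.re_trace_nonneg
      rw [Matrix.trace_fromBlocks, re_add] at this
      rw [← h0]
      linarith
    · have h1 := habs.smul (inv_nonneg.2 hpos.le)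
      rw [Matrix.conjTranspose_real_smul, Matrix.fromBlocks_smul, inv_smul_smul₀ hpos.ne',
        inv_smul_smul₀ hpos.ne'] at h1
      have h2 := hmin _ h1
      rw [Matrix.trace_smul, Quaternion.re_smul, smul_eq_mul] at h2
      rwa [le_inv_mul_iff₀ hpos, mul_comm] at h2) (by
    rintro ⟨X, t⟩
    obtain ⟨c, hc⟩ := (X + t • qH Y).2.exists_qPosSemidef_smul_one_add
    let I : QHerm (Fin n) := ⟨c • 1, (QHerm (Fin n)).smul_mem c Matrix.isHermitian_one⟩
    refine ⟨⟨L (I, 0), _, rfl⟩, ?_⟩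
    change QPosSemidef (qDiag I + X + ((0 : ℝ) + t) • qH Y : QHerm (Fin n ⊕ Fin n)).1
    convert hc using 1
    rw [zero_add, add_assoc]
    simp [qDiag, I, ← Matrix.fromBlocks_one, Matrix.fromBlocks_smul])
  obtain ⟨Z, hZ, hgZ⟩ := exists_eq_re_trace_mul
    (g ∘ₗ LinearMap.inl ℝ (QHerm (Fin n ⊕ Fin n)) ℝ)
  refine ⟨Z, ⟨hZ, fun x => ?_⟩, fun W => ?_, ?_⟩
  · rw [← re_trace_vecMulVec_star_mul,
      ← hgZ ⟨Matrix.vecMulVec x (star x), (qPosSemidef_vecMulVec_star x).1⟩]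
    refine hgs _ ?_
    change QPosSemidef _
    simpa using qPosSemidef_vecMulVec_star x
  · rw [← hgZ]
    have h1 := (hg ⟨L (W, 0), _, rfl⟩).trans (hf (W, 0))
    rw [hφ, mul_zero, sub_zero] at h1
    exact h1
  · have h1 := (hg ⟨L (0, 1), _, rfl⟩).trans (hf (0, 1))
    rw [hφ] at h1
    -- Both `(H(Y), -1)` and its negative lie in the cone, so `g (H(Y), 0) = g (0, 1) = -tr V`.
    have h2 : 0 ≤ g (qH Y, -1) := hgs _ (by
      change QPosSemidef _
      simpa using qPosSemidef_zero)
    have h3 : 0 ≤ g (-qH Y, 1) := hgs _ (by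
      change QPosSemidef _
      simpa using qPosSemidef_zero)
    have h4 : L (0, 1) = (0, 1) := by simp [L]
    have h5 : ((qH Y, (-1 : ℝ)) : QHerm (Fin n ⊕ Fin n) × ℝ) = (qH Y, 0) - (0, 1) := by simp
    have h6 : ((-qH Y, (1 : ℝ)) : QHerm (Fin n ⊕ Fin n) × ℝ) = (0, 1) - (qH Y, 0) := by simp
    rw [h5, map_sub] at h2
    rw [h6, map_sub] at h3
    rw [Matrix.neg_mul, Matrix.trace_neg, Quaternion.re_neg, ← hgZ]
    have h7 : (g ∘ₗ LinearMap.inl ℝ (QHerm (Fin n ⊕ Fin n)) ℝ) (qH Y) = g (qH Y, 0) := rfl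
    rw [h7]
    simp only [h4] at h1
    simp at h1
    linarith

/-- A dual feasible `Z = [P, B; B*, Q]` yields `A = -2B` with `r(A) ≤ 1`: the form of `Z` at
`(x, xu)`, with `u` a unit quaternion rotating `x* B x` onto the negative real axis, equals
`x* (P + Q) x - 2 |x* B x|`, and the constraints on `Z` give `x* (P + Q) x = ‖x‖²`. -/
theorem exists_qNumRadius_le_one_of_dual {Y : Matrix (Fin n) (Fin n) ℍ[ℝ]}
    {Z : Matrix (Fin n ⊕ Fin n) (Fin n ⊕ Fin n) ℍ[ℝ]} (hZ : QPosSemidef Z)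
    (hd : ∀ W : QHerm (Fin n),
      ((qDiag W : Matrix (Fin n ⊕ Fin n) (Fin n ⊕ Fin n) ℍ[ℝ]) * Z).trace.re =
        (W : Matrix (Fin n) (Fin n) ℍ[ℝ]).trace.re) :
    ∃ A : Matrix (Fin n) (Fin n) ℍ[ℝ], qNumRadius A ≤ 1 ∧
      (-(qH Y : Matrix (Fin n ⊕ Fin n) (Fin n ⊕ Fin n) ℍ[ℝ]) * Z).trace.re =
        (A.conjTranspose * Y).trace.re := by
  obtain ⟨P, B, C, Q, rfl⟩ : ∃ P B C Q, Z = Matrix.fromBlocks P B C Q :=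
    ⟨_, _, _, _, (Matrix.fromBlocks_toBlocks Z).symm⟩
  obtain ⟨hP, rfl, -, hQ⟩ := Matrix.isHermitian_fromBlocks_iff.1 hZ.1
  refine ⟨(-2 : ℝ) • B, qNumRadius_le zero_le_one fun x hx => ?_, ?_⟩
  · obtain ⟨u, hu, hu'⟩ := Quaternion.exists_norm_one_mul_eq (qForm B x)
    have hright : ∀ D : Matrix (Fin n) (Fin n) ℍ[ℝ],
        D.mulVec (fun i => x i * u) = fun i => D.mulVec x i * u := fun D => by
      ext1 i
      simp [Matrix.mulVec, dotProduct, Finset.sum_mul, mul_assoc]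
    have h1 := hZ.2 (Sum.elim x fun i => x i * u)
    have hB1 : star x ⬝ᵥ B.mulVec (fun i => x i * u) = qForm B x * u := by
      rw [hright, qForm]
      simp [dotProduct, Finset.sum_mul, mul_assoc]
    have hB2 : (star (fun i => x i * u) ⬝ᵥ B.conjTranspose.mulVec x).re = (qForm B x * u).re := by
      rw [← hB1, Matrix.dotProduct_mulVec, ← Matrix.star_mulVec, ← Quaternion.re_star,
        Matrix.star_dotProduct, star_star]
    have hQ1 : qForm Q (fun i => x i * u) = star u * qForm Q x * u := by
      rw [qForm, hright, qForm]
      simp [dotProduct, Finset.sum_mul, Finset.mul_sum, mul_assoc]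
    rw [qForm_fromBlocks, re_add, re_add, re_add, hB1, hB2, hQ1, Quaternion.re_star_mul_mul, hu,
      hu'] at h1
    have h2 := hd ⟨Matrix.vecMulVec x (star x), (qPosSemidef_vecMulVec_star x).1⟩
    simp only [qDiag, Matrix.fromBlocks_multiply, Matrix.trace_fromBlocks, Matrix.zero_mul,
      add_zero, zero_add, re_add, re_trace_vecMulVec_star_mul, re_trace_vecMulVec_star, hx] at h2
    rw [qForm_smul_left, norm_smul]
    norm_num
    linarith
  · have h1 : (Y.conjTranspose * B).trace.re = (B.conjTranspose * Y).trace.re := by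
      rw [← Quaternion.re_star, ← Matrix.trace_conjTranspose, Matrix.conjTranspose_mul,
        Matrix.conjTranspose_conjTranspose]
    simp only [qH, Matrix.neg_mul, Matrix.trace_neg, Quaternion.re_neg, Matrix.fromBlocks_multiply,
      Matrix.trace_fromBlocks, Matrix.zero_mul, add_zero, zero_add, re_add]
    rw [h1, Matrix.re_trace_mul_comm, Matrix.conjTranspose_real_smul, Matrix.smul_mul,
      Matrix.trace_smul, Quaternion.re_smul, smul_eq_mul]
    ring

/-- Optimal solutions of both problems exist, and their common value is the dual norm. The matrix
`A` obtained from the dual solution attains the maximum that defines the dual norm. -/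
theorem exists_primal_dual_eq_qNumRadiusDual (Y : Matrix (Fin n) (Fin n) ℍ[ℝ]) :
    ∃ (V : Matrix (Fin n) (Fin n) ℍ[ℝ]) (Z : Matrix (Fin n ⊕ Fin n) (Fin n ⊕ Fin n) ℍ[ℝ]),
      QPosSemidef (Matrix.fromBlocks V Y Y.conjTranspose V) ∧ V.trace.re = qNumRadiusDual Y ∧
      QPosSemidef Z ∧
      (∀ W : QHerm (Fin n), ((qDiag W : Matrix (Fin n ⊕ Fin n) (Fin n ⊕ Fin n) ℍ[ℝ]) * Z).trace.re =
        (W : Matrix (Fin n) (Fin n) ℍ[ℝ]).trace.re) ∧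
      (-(qH Y : Matrix (Fin n ⊕ Fin n) (Fin n ⊕ Fin n) ℍ[ℝ]) * Z).trace.re = qNumRadiusDual Y := by
  obtain ⟨V, hV, hmin⟩ := exists_forall_re_trace_le Y
  obtain ⟨Z, hZ, hd, hval⟩ := exists_dual_of_forall_re_trace_le hV hmin
  obtain ⟨A, hA, hAY⟩ := exists_qNumRadius_le_one_of_dual (Y := Y) hZ hd
  have h : qNumRadiusDual Y = V.trace.re := by
    refine IsGreatest.csSup_eq ⟨⟨A, hA, hval.symm.trans hAY⟩, ?_⟩
    rintro t ⟨B, hB, rfl⟩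
    exact re_trace_conjTranspose_mul_le hB hV
  exact ⟨V, Z, hV, h.symm, hZ, hd, hval.trans h.symm⟩

theorem qNumRadiusDual_le_re_trace {V Y : Matrix (Fin n) (Fin n) ℍ[ℝ]}
    (hV : QPosSemidef (Matrix.fromBlocks V Y Y.conjTranspose V)) :
    qNumRadiusDual Y ≤ V.trace.re := by
  refine csSup_le ⟨0, 0, qNumRadius_le zero_le_one fun x _ => by simp [qForm], by simp⟩ ?_
  rintro t ⟨B, hB, rfl⟩
  exact re_trace_conjTranspose_mul_le hB hV

theorem re_trace_neg_qH_mul_le_qNumRadiusDual (Y : Matrix (Fin n) (Fin n) ℍ[ℝ])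
    {Z : Matrix (Fin n ⊕ Fin n) (Fin n ⊕ Fin n) ℍ[ℝ]} (hZ : QPosSemidef Z)
    (hd : ∀ W : QHerm (Fin n),
      ((qDiag W : Matrix (Fin n ⊕ Fin n) (Fin n ⊕ Fin n) ℍ[ℝ]) * Z).trace.re =
        (W : Matrix (Fin n) (Fin n) ℍ[ℝ]).trace.re) :
    (-(qH Y : Matrix (Fin n ⊕ Fin n) (Fin n ⊕ Fin n) ℍ[ℝ]) * Z).trace.re ≤ qNumRadiusDual Y := by
  obtain ⟨A, hA, hAY⟩ := exists_qNumRadius_le_one_of_dual (Y := Y) hZ hd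
  obtain ⟨V, hV, -⟩ := exists_forall_re_trace_le Y
  refine le_csSup ⟨V.trace.re, ?_⟩ ⟨A, hA, hAY⟩
  rintro t ⟨B, hB, rfl⟩
  exact re_trace_conjTranspose_mul_le hB hV

end Duality

/-! ### The dimension of the space of selfadjoint matrices -/

section Dimension

theorem Fin.card_lt_pairs (n : ℕ) :
    2 * Fintype.card {p : Fin n × Fin n // p.1 < p.2} + n = n * n := by
  have h : Fintype.card {p : Fin n × Fin n // p.1 < p.2} = ∑ i ∈ Finset.range n, i := by
    rw [Fintype.card_subtype, Finset.card_filter, Fintype.sum_prod_type_right,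
      ← Fin.sum_univ_eq_sum_range (fun i => i)]
    refine Finset.sum_congr rfl fun j _ => ?_
    rw [← Finset.card_filter, ← Fin.card_Iio]
    congr 1
    ext i
    simp
  rw [h, mul_comm, Finset.sum_range_id_mul_two]
  cases n with
  | zero => rfl
  | succ n => simp; ring

/-- The real diagonal entries and the entries above the diagonal, which determine a selfadjoint
matrix and can be prescribed freely. -/
def qHermEntries (n : ℕ) :
    QHerm (Fin n) →ₗ[ℝ] (Fin n → ℝ) × ({p : Fin n × Fin n // p.1 < p.2} → ℍ[ℝ]) where
  toFun A := (fun i => (A.1 i i).re, fun p => A.1 p.1.1 p.1.2)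
  map_add' _ _ := rfl
  map_smul' _ _ := rfl

theorem qHermEntries_bijective (n : ℕ) : Function.Bijective (qHermEntries n) := by
  constructor
  · rw [injective_iff_map_eq_zero]
    intro A hA
    have h1 : ∀ i, (A.1 i i).re = 0 := fun i => congrFun (congrArg Prod.fst hA) i
    have h2 : ∀ i j, i < j → A.1 i j = 0 := fun i j hij =>
      congrFun (congrArg Prod.snd hA) ⟨(i, j), hij⟩
    have hA' : ∀ i j, star (A.1 j i) = A.1 i j := fun i j => Matrix.IsHermitian.apply A.2 i j
    ext1
    ext i j : 1
    rcases lt_trichotomy i j with h | rfl | h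
    · exact h2 i j h
    · have := Quaternion.star_eq_self.1 (hA' i i)
      rw [this, h1]
      rfl
    · rw [← hA', h2 j i h, star_zero]
      rfl
  · rintro ⟨d, f⟩
    refine ⟨⟨Matrix.of fun i j => if h : i < j then f ⟨(i, j), h⟩ else
      if h : j < i then star (f ⟨(j, i), h⟩) else (d i : ℍ[ℝ]), ?_⟩, ?_⟩
    · ext i j : 1
      rcases lt_trichotomy i j with h | rfl | h
      · simp [Matrix.conjTranspose_apply, h, h.not_gt]
      · simp [Matrix.conjTranspose_apply]
      · simp [Matrix.conjTranspose_apply, h, h.not_gt]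
    · refine Prod.ext ?_ ?_
      · ext i
        change QuaternionAlgebra.re (dite _ _ _) = d i
        simp
      · ext1 p
        change dite _ _ _ = f p
        rw [dif_pos p.2]

theorem finrank_qHerm (n : ℕ) : Module.finrank ℝ (QHerm (Fin n)) = n * (2 * n - 1) := by
  rw [(LinearEquiv.ofBijective _ (qHermEntries_bijective n)).finrank_eq, Module.finrank_prod,
    Module.finrank_pi_fintype]
  simp only [Module.finrank_self, Finset.sum_const,
    Module.finrank_pi_fintype, Quaternion.finrank_eq_four, smul_eq_mul, Finset.card_univ, mul_one,
    Fintype.card_fin]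
  have h := Fin.card_lt_pairs n
  rw [Nat.mul_sub, mul_one]
  have h2 : n * (2 * n) = 2 * (n * n) := by ring
  omega

/-- The matrix `(1/n) I_n`, as an element of `H_n(ℍ)`. -/
noncomputable def qHermInvSmulOne (n : ℕ) : QHerm (Fin n) :=
  ⟨(1 / (n : ℝ)) • 1, (QHerm (Fin n)).smul_mem _ Matrix.isHermitian_one⟩

theorem qTrace_qHermInvSmulOne {n : ℕ} (hn : 1 ≤ n) : qTrace (Fin n) (qHermInvSmulOne n) = 1 := by
  have : (n : ℝ) ≠ 0 := by positivity
  simp [qTrace, qHermInvSmulOne, this]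

/-- A vector on which a functional takes the value `1` is completed to a basis by a basis of the
kernel. -/
theorem Module.Basis.exists_cons_ker {E : Type*} [AddCommGroup E] [Module ℝ E]
    [Module.Finite ℝ E] {K : ℕ} (hK : Module.finrank ℝ E = K) (τ : E →ₗ[ℝ] ℝ) {e : E}
    (he : τ e = 1) : ∃ W : Module.Basis (Fin K) ℝ E, ∀ i : Fin K,
      ((i : ℕ) = 0 → W i = e) ∧ ((i : ℕ) ≠ 0 → τ (W i) = 0) := by
  have hsurj : Function.Surjective τ := fun r =>
    ⟨r • e, by rw [map_smul, he, smul_eq_mul, mul_one]⟩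
  have hker := LinearMap.finrank_range_add_finrank_ker τ
  rw [LinearMap.range_eq_top.2 hsurj, finrank_top, Module.finrank_self, hK] at hker
  obtain ⟨m, rfl⟩ : ∃ m, K = m + 1 := ⟨_, by rw [← hker, add_comm]⟩
  let b := Module.finBasisOfFinrankEq ℝ (LinearMap.ker τ) (n := m) (by omega)
  refine ⟨Module.Basis.mkFinCons e b (fun c x hx h => ?_) (fun z => ⟨-τ z, ?_⟩), fun i => ?_⟩
  · have h1 := congrArg τ h
    rw [map_add, map_smul, he, LinearMap.mem_ker.1 hx, map_zero] at h1
    simpa using h1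
  · rw [LinearMap.mem_ker, map_add, map_smul, he, smul_eq_mul, mul_one, add_neg_cancel]
  · rw [Module.Basis.coe_mkFinCons]
    exact Fin.cases ⟨fun _ => rfl, fun h => absurd rfl h⟩ (fun j => ⟨fun h => by simp at h,
      fun _ => (b j).2⟩) i

end Dimension

/-! ### The semidefinite program in an adapted basis -/

section Program

variable {n : ℕ} {Y : Matrix (Fin n) (Fin n) ℍ[ℝ]}
  {W : Module.Basis (Fin (n * (2 * n - 1))) ℝ (QHerm (Fin n))}

theorem exists_isAdapted (hn : 1 ≤ n) :
    ∃ W : Module.Basis (Fin (n * (2 * n - 1))) ℝ (QHerm (Fin n)), IsAdapted W := by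
  have : Module.Finite ℝ (QHerm (Fin n)) :=
    Module.Finite.equiv (LinearEquiv.ofBijective _ (qHermEntries_bijective n)).symm
  obtain ⟨W, hW⟩ := Module.Basis.exists_cons_ker (finrank_qHerm n) (qTrace (Fin n))
    (qTrace_qHermInvSmulOne hn)
  refine ⟨W, fun i => ⟨fun h => by rw [(hW i).1 h]; rfl, fun h => ?_⟩⟩
  rw [Matrix.IsHermitian.trace_eq_coe (W i).2]
  have := (hW i).2 h
  exact congrArg _ this

theorem IsAdapted.qTrace_apply (hn : 1 ≤ n) (hW : IsAdapted W) (i : Fin (n * (2 * n - 1))) :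
    qTrace (Fin n) (W i) = if (i : ℕ) = 0 then 1 else 0 := by
  split_ifs with h
  · rw [← qTrace_qHermInvSmulOne hn]
    exact congrArg _ (Subtype.ext ((hW i).1 h))
  · have h1 := (hW i).2 h
    change (W i).1.trace.re = 0
    rw [h1]
    rfl

theorem linearIndependent_dualRadiusSDP_X : LinearIndependent ℝ (dualRadiusSDP Y W).X :=
  W.linearIndependent.map' (qDiagLinear n) (LinearMap.ker_eq_bot.2 (qDiagLinear_injective n))

theorem linearIndependent_finCons_dualRadiusSDP (hY : Y ≠ 0) :
    LinearIndependent ℝ (Fin.cons (dualRadiusSDP Y W).X₀ (dualRadiusSDP Y W).X :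
      Fin (n * (2 * n - 1) + 1) → QHerm (Fin n ⊕ Fin n)) := by
  refine linearIndependent_finCons.2 ⟨linearIndependent_dualRadiusSDP_X, fun hmem => hY ?_⟩
  have hle : Submodule.span ℝ (Set.range (dualRadiusSDP Y W).X) ≤
      LinearMap.range (qDiagLinear n) :=
    Submodule.span_le.2 (by rintro _ ⟨i, rfl⟩; exact ⟨W i, rfl⟩)
  obtain ⟨A, hA⟩ := hle hmem
  have := congrArg (fun X : QHerm (Fin n ⊕ Fin n) => X.1.toBlocks₁₂) hA
  simpa [qDiagLinear, qDiag, dualRadiusSDP, qH] using this.symm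

theorem pencil_dualRadiusSDP (s : Fin (n * (2 * n - 1)) → ℝ) :
    (dualRadiusSDP Y W).pencil s =
      Matrix.fromBlocks (∑ i, s i • W i : QHerm (Fin n)).1 Y Y.conjTranspose
        (∑ i, s i • W i : QHerm (Fin n)).1 := by
  have h := qDiag_add_smul_qH (∑ i, s i • W i) 1 Y
  rw [one_smul, one_smul] at h
  rw [← h, add_comm]
  have h2 : qDiag (∑ i, s i • W i) = ∑ i, s i • qDiag (W i) := by
    change qDiagLinear n _ = ∑ i, s i • qDiagLinear n (W i)
    simp
  rw [h2]
  simp [QSDP.pencil, dualRadiusSDP]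

theorem objective_dualRadiusSDP (hn : 1 ≤ n) (hW : IsAdapted W)
    (s : Fin (n * (2 * n - 1)) → ℝ) :
    (dualRadiusSDP Y W).objective s = qTrace (Fin n) (∑ i, s i • W i) := by
  rw [map_sum]
  refine Finset.sum_congr rfl fun i _ => ?_
  rw [map_smul, hW.qTrace_apply hn, smul_eq_mul, mul_comm]
  rfl

theorem isLeast_objective_dualRadiusSDP (hn : 1 ≤ n) (hW : IsAdapted W) :
    IsLeast ((dualRadiusSDP Y W).objective '' (dualRadiusSDP Y W).feasible)
      (qNumRadiusDual Y) := by
  obtain ⟨V, Z, hV, hVt, -⟩ := exists_primal_dual_eq_qNumRadiusDual Y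
  constructor
  · have hsum := W.sum_repr ⟨V, (Matrix.isHermitian_fromBlocks_iff.1 hV.1).1⟩
    refine ⟨W.repr ⟨V, (Matrix.isHermitian_fromBlocks_iff.1 hV.1).1⟩, ?_, ?_⟩
    · change QPosSemidef _
      rwa [pencil_dualRadiusSDP, hsum]
    · rw [objective_dualRadiusSDP hn hW, hsum]
      exact hVt
  · rintro _ ⟨s, hs, rfl⟩
    rw [objective_dualRadiusSDP hn hW]
    have hs' : QPosSemidef _ := hs
    rw [pencil_dualRadiusSDP] at hs'
    exact qNumRadiusDual_le_re_trace hs'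

theorem re_trace_qDiag_mul_eq_of_basis (hn : 1 ≤ n) (hW : IsAdapted W)
    {Z : Matrix (Fin n ⊕ Fin n) (Fin n ⊕ Fin n) ℍ[ℝ]}
    (h : ∀ i, ((qDiag (W i)).1 * Z).trace.re = if (i : ℕ) = 0 then 1 else 0) (A : QHerm (Fin n)) :
    ((qDiag A).1 * Z).trace.re = A.1.trace.re := by
  let F : QHerm (Fin n ⊕ Fin n) →ₗ[ℝ] ℝ :=
    { toFun X := (X.1 * Z).trace.re
      map_add' X X' := by simp [Matrix.add_mul, Matrix.trace_add]
      map_smul' c X := by simp [Matrix.trace_smul] }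
  have : F ∘ₗ qDiagLinear n = qTrace (Fin n) :=
    W.ext fun i => (h i).trans (hW.qTrace_apply hn i).symm
  exact LinearMap.congr_fun this A

theorem mem_dualFeasible_dualRadiusSDP (hn : 1 ≤ n) (hW : IsAdapted W)
    {Z : Matrix (Fin n ⊕ Fin n) (Fin n ⊕ Fin n) ℍ[ℝ]} :
    Z ∈ (dualRadiusSDP Y W).dualFeasible ↔ QPosSemidef Z ∧
      ∀ A : QHerm (Fin n), ((qDiag A).1 * Z).trace.re = A.1.trace.re :=
  and_congr_right fun _ => ⟨fun h => re_trace_qDiag_mul_eq_of_basis hn hW h,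
    fun h i => (h (W i)).trans (hW.qTrace_apply hn i)⟩

theorem re_trace_qDiag_qHermInvSmulOne_mul (Z : Matrix (Fin n ⊕ Fin n) (Fin n ⊕ Fin n) ℍ[ℝ]) :
    ((qDiag (qHermInvSmulOne n)).1 * Z).trace.re = 1 / n * Z.trace.re := by
  have h : (qDiag (qHermInvSmulOne n)).1 = (1 / (n : ℝ)) • 1 := by
    simp [qDiag, qHermInvSmulOne, ← Matrix.fromBlocks_one, Matrix.fromBlocks_smul]
  rw [h, Matrix.smul_mul, one_mul, Matrix.trace_smul, Quaternion.re_smul, smul_eq_mul]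

/-- The constraint `Re tr (X_1 Z) = 1` reads `tr Z = n`, as `X_1 = (1/n) I` and the trace of a
selfadjoint matrix is real. -/
theorem trace_conditions_iff_mem_dualFeasible (hn : 1 ≤ n) (hW : IsAdapted W)
    {Z : Matrix (Fin n ⊕ Fin n) (Fin n ⊕ Fin n) ℍ[ℝ]} :
    (QPosSemidef Z ∧ Z.trace = (n : ℍ[ℝ]) ∧ ∀ i : Fin (n * (2 * n - 1)), (i : ℕ) ≠ 0 →
      (((dualRadiusSDP Y W).X i).1 * Z).trace.re = 0) ↔ Z ∈ (dualRadiusSDP Y W).dualFeasible := by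
  have hn0 : (n : ℝ) ≠ 0 := by positivity
  have hk : 0 < n * (2 * n - 1) := Nat.mul_pos hn (by omega)
  refine and_congr_right fun hZ => ?_
  have htr : Z.trace = (n : ℍ[ℝ]) ↔ Z.trace.re = n := by
    constructor
    · intro h
      rw [h, Quaternion.re_natCast]
    · intro h
      rw [hZ.1.trace_eq_coe, h, Quaternion.coe_natCast]
  have hX : ∀ i : Fin (n * (2 * n - 1)), (i : ℕ) = 0 →
      (((dualRadiusSDP Y W).X i).1 * Z).trace.re = 1 / n * Z.trace.re := by
    intro i hi
    rw [← re_trace_qDiag_qHermInvSmulOne_mul]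
    have : W i = qHermInvSmulOne n := Subtype.ext ((hW i).1 hi)
    rw [← this]
    rfl
  rw [htr]
  constructor
  · rintro ⟨h1, h2⟩ i
    by_cases hi : (i : ℕ) = 0
    · rw [hX i hi, h1]
      simp [dualRadiusSDP, hi, hn0]
    · rw [h2 i hi]
      simp [dualRadiusSDP, hi]
  · intro h
    refine ⟨?_, fun i hi => ?_⟩
    · have h0 := h ⟨0, hk⟩
      rw [hX _ rfl] at h0
      simp only [dualRadiusSDP, if_true] at h0
      field_simp at h0
      exact h0
    · rw [h i]
      simp [dualRadiusSDP, hi]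

theorem isGreatest_dualObjective_dualRadiusSDP (hn : 1 ≤ n) (hW : IsAdapted W) :
    IsGreatest ((dualRadiusSDP Y W).dualObjective '' (dualRadiusSDP Y W).dualFeasible)
      (qNumRadiusDual Y) := by
  have hobj : ∀ Z, (dualRadiusSDP Y W).dualObjective Z = (-(qH Y).1 * Z).trace.re := fun Z => by
    rw [Matrix.neg_mul, Matrix.trace_neg, Quaternion.re_neg]; rfl
  constructor
  · obtain ⟨V, Z, -, -, hZ, hd, hval⟩ := exists_primal_dual_eq_qNumRadiusDual Y
    exact ⟨Z, (mem_dualFeasible_dualRadiusSDP hn hW).2 ⟨hZ, hd⟩, (hobj Z).trans hval⟩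
  · rintro _ ⟨Z, hZ, rfl⟩
    obtain ⟨hZ, hd⟩ := (mem_dualFeasible_dualRadiusSDP hn hW).1 hZ
    rw [hobj]
    exact re_trace_neg_qH_mul_le_qNumRadiusDual Y hZ hd

theorem QSDP.val_eq_of_isLeast {m : Type} [Fintype m] {k : ℕ} {P : QSDP m k} {r : ℝ}
    (h : IsLeast (P.objective '' P.feasible) r) : P.val = (r : EReal) := by
  obtain ⟨⟨s, hs, rfl⟩, hlb⟩ := h
  exact le_antisymm (iInf₂_le s hs) (le_iInf₂ fun t ht => EReal.coe_le_coe_iff.2 (hlb ⟨t, ht, rfl⟩))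

theorem QSDP.dualVal_eq_of_isGreatest {m : Type} [Fintype m] {k : ℕ} {P : QSDP m k} {r : ℝ}
    (h : IsGreatest (P.dualObjective '' P.dualFeasible) r) : P.dualVal = (r : EReal) := by
  obtain ⟨⟨Z, hZ, rfl⟩, hub⟩ := h
  exact le_antisymm (iSup₂_le fun Z' hZ' => EReal.coe_le_coe_iff.2 (hub ⟨Z', hZ', rfl⟩))
    (le_iSup₂ (f := fun Z (_ : Z ∈ P.dualFeasible) => (P.dualObjective Z : EReal)) Z hZ)

theorem isLeast_trace_qNumRadiusDual (Y : Matrix (Fin n) (Fin n) ℍ[ℝ]) :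
    IsLeast {t : ℝ | ∃ V : Matrix (Fin n) (Fin n) ℍ[ℝ],
      QPosSemidef (Matrix.fromBlocks V Y Y.conjTranspose V) ∧ V.trace = (t : ℍ[ℝ])}
      (qNumRadiusDual Y) := by
  constructor
  · obtain ⟨V, Z, hV, hVt, -⟩ := exists_primal_dual_eq_qNumRadiusDual Y
    exact ⟨V, hV, by rw [← hVt, ← (Matrix.isHermitian_fromBlocks_iff.1 hV.1).1.trace_eq_coe]⟩
  · rintro t ⟨V, hV, ht⟩
    have := qNumRadiusDual_le_re_trace hV
    rwa [ht, Quaternion.re_coe] at this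

end Program

theorem lemma5p4 (n : ℕ) (hn : 1 ≤ n) (Y : Matrix (Fin n) (Fin n) ℍ[ℝ]) :
    -- the characterization of the dual norm to be rewritten
    IsLeast {t : ℝ | ∃ V : Matrix (Fin n) (Fin n) ℍ[ℝ],
      QPosSemidef (Matrix.fromBlocks V Y Y.conjTranspose V) ∧ V.trace = (t : ℍ[ℝ])}
      (qNumRadiusDual Y) ∧
    -- adapted bases with `k = n(2n-1)` elements exist
    (∃ W : Module.Basis (Fin (n * (2 * n - 1))) ℝ (QHerm (Fin n)), IsAdapted W) ∧
    ∀ W : Module.Basis (Fin (n * (2 * n - 1))) ℝ (QHerm (Fin n)), IsAdapted W →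
      -- the data of the program satisfy the normalization of the standard form
      LinearIndependent ℝ (dualRadiusSDP Y W).X ∧
      ((dualRadiusSDP Y W).X₀ = 0 ∨
        LinearIndependent ℝ (Fin.cons (dualRadiusSDP Y W).X₀ (dualRadiusSDP Y W).X :
          Fin (n * (2 * n - 1) + 1) → QHerm (Fin n ⊕ Fin n))) ∧
      -- the program is the characterization, in the coordinates `V = ∑ i, s i • W i`
      Function.Bijective (fun s : Fin (n * (2 * n - 1)) → ℝ => ∑ i, s i • W i) ∧
      (∀ s : Fin (n * (2 * n - 1)) → ℝ, ∀ V : QHerm (Fin n), V = ∑ i, s i • W i →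
        (dualRadiusSDP Y W).pencil s =
          Matrix.fromBlocks (V : Matrix (Fin n) (Fin n) ℍ[ℝ]) Y Y.conjTranspose
            (V : Matrix (Fin n) (Fin n) ℍ[ℝ]) ∧
        (V : Matrix (Fin n) (Fin n) ℍ[ℝ]).trace =
          (((dualRadiusSDP Y W).objective s : ℝ) : ℍ[ℝ])) ∧
      IsLeast ((dualRadiusSDP Y W).objective '' (dualRadiusSDP Y W).feasible)
        (qNumRadiusDual Y) ∧
      -- strong duality
      (dualRadiusSDP Y W).val = (qNumRadiusDual Y : EReal) ∧
      (dualRadiusSDP Y W).dualVal = (dualRadiusSDP Y W).val ∧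
      -- the dual program, with the maximum attained
      IsGreatest {v : ℝ | ∃ Z : Matrix (Fin n ⊕ Fin n) (Fin n ⊕ Fin n) ℍ[ℝ],
        QPosSemidef Z ∧ Z.trace = (n : ℍ[ℝ]) ∧
        (∀ i : Fin (n * (2 * n - 1)), (i : ℕ) ≠ 0 →
          (((dualRadiusSDP Y W).X i : Matrix (Fin n ⊕ Fin n) (Fin n ⊕ Fin n) ℍ[ℝ]) * Z).trace.re
            = 0) ∧
        v = (-(qH Y : Matrix (Fin n ⊕ Fin n) (Fin n ⊕ Fin n) ℍ[ℝ]) * Z).trace.re}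
        (qNumRadiusDual Y) := by
  refine ⟨isLeast_trace_qNumRadiusDual Y, exists_isAdapted hn, fun W hW => ?_⟩
  have hP := isLeast_objective_dualRadiusSDP (Y := Y) hn hW
  have hD := isGreatest_dualObjective_dualRadiusSDP (Y := Y) hn hW
  have hval := QSDP.val_eq_of_isLeast hP
  refine ⟨linearIndependent_dualRadiusSDP_X, ?_, ?_, ?_, hP, hval,
    (QSDP.dualVal_eq_of_isGreatest hD).trans hval.symm, ?_⟩
  · by_cases hY : Y = 0
    · left
      subst hY
      exact Subtype.ext (by simp [dualRadiusSDP, qH])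
    · exact Or.inr (linearIndependent_finCons_dualRadiusSDP hY)
  · have h := W.equivFun.symm.bijective
    convert h using 2 with s
    exact (W.equivFun_symm_apply s).symm
  · rintro s V rfl
    refine ⟨pencil_dualRadiusSDP s, ?_⟩
    rw [objective_dualRadiusSDP hn hW]
    exact Matrix.IsHermitian.trace_eq_coe (∑ i, s i • W i : QHerm (Fin n)).2
  · convert hD using 1
    ext v
    simp only [Set.mem_image, ← trace_conditions_iff_mem_dualFeasible hn hW, and_assoc]
    refine exists_congr fun Z => and_congr_right fun _ => and_congr_right fun _ =>
      and_congr_right fun _ => ?_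
    rw [Matrix.neg_mul, Matrix.trace_neg, Quaternion.re_neg, eq_comm]
    rfl
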